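/- Consider a network with finitely many sources $s_1,\dots,s_m$, routes $r_1,\dots,r_n$ and links $l_1,\dots,l_q$. Each route $r_j$ has a unique source (write $r_j\sim s_i$ if $s_i$ is the source of $r_j$) and uses a set of links (write $r_j\sim l_k$ if $r_j$ uses $l_k$); link $l_k$ has capacity $C_k\ge 0$. Let $A\in\mathbb{R}^{q\times n}$ be given by $A_{kj}=1$ if $r_j\sim l_k$ and $A_{kj}=0$ otherwise, and let $H\in\mathbb{R}^{m\times n}$ be given by $H_{ij}=1$ if $r_j\sim s_i$ and $H_{ij}=0$ otherwise. For each $i$ let $U_i:[0,\infty)\to\mathbb{R}$ be $C^2$ (one-sided derivatives at $0$), strictly concave and strictly increasing, and put $$\varphi(x,y)=\sum_i U_i\Big(\sum_{r_j\sim s_i}x_j\Big)+y^T(C-Ax),\qquad x\in\mathbb{R}^n_+,\ y\in\mathbb{R}^q_+ .$$ Consider on $K=\mathbb{R}^{n}_+\times\mathbb{R}^q_+$, with the Euclidean metric, the subgradient dynamics $$\dot x_j=\Big[U_{i(j)}'\Big(\sum_{r_k\sim s_{i(j)}}x_k\Big)-\sum_{l_k\sim r_j}y_k\Big]^+_{x_j},\qquad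 \dot y_k=\Big[\sum_{r_j\sim l_k}x_j-C_k\Big]^+_{y_k},$$ where $s_{i(j)}$ is the source of $r_j$, and $[a]^+_b=a$ if $b>0$ and $[a]^+_b=\max(a,0)$ if $b=0$. A (Carathéodory) solution is a map $z:[0,\infty)\to K$ that is absolutely continuous on compact intervals and satisfies these equations for almost every $t$. Suppose that there is $(\bar x,\bar y)$ with all coordinates strictly positive that is a saddle point of $\varphi$, i.e. $\varphi(x,\bar y)\le\varphi(\bar x,\bar y)\le\varphi(\bar x,y)$ for all $x\in\mathbb{R}^n_+$ and $y\in\mathbb{R}^q_+$. Then the solutions form a (unique) continuous semi-flow on $K$: from each point of $K$ there starts exactly one solution, and it depends continuously on time and initial point. This semi-flow is globally convergent, that is, the distance of every solution $z(t)$ from the set of equilibrium points tends to $0$ as $t\to\infty$, if and only if there do not exist $u\in\ker H\setminus\{0\}$ and $\lambda>0$ with $A^TAu=\lambda u$. -/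

import Mathlib

open MeasureTheory Filter Topology Set
open scoped NNReal ENNReal Matrix

/-- A network with sources `S`, routes `R` and links `L`: every route `r` has a unique source
`source r` and uses a set `links r` of links; every link has a nonnegative capacity. -/
structure MultipathNetwork (S R L : Type*) where
  source : R → S
  links : R → Finset L
  capacity : L → ℝ
  capacity_nonneg : ∀ l, 0 ≤ capacity l

/-- The positive projection `[a]^+_x`: it is `a` where `x > 0` and `max a 0` where `x = 0`. -/
noncomputable def posProj (a x : ℝ) : ℝ := if 0 < x then a else max a 0

namespace MultipathNetwork

variable {S R L : Type*} [Fintype S] [Fintype R] [Fintype L] [DecidableEq S] [DecidableEq L]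

/-- The link-route connectivity matrix `A`. -/
def linkMatrix (N : MultipathNetwork S R L) : Matrix L R ℝ :=
  Matrix.of fun l r => if l ∈ N.links r then 1 else 0

/-- The source-route matrix `H`. -/
def sourceMatrix (N : MultipathNetwork S R L) : Matrix S R ℝ :=
  Matrix.of fun s r => if N.source r = s then 1 else 0

/-- The total usage of the routes of the source `s`. -/
def sourceRate (N : MultipathNetwork S R L) (x : R → ℝ) (s : S) : ℝ :=
  ∑ r with N.source r = s, x r

/-- The total usage of the routes through the link `l`. -/
def linkLoad (N : MultipathNetwork S R L) (x : R → ℝ) (l : L) : ℝ :=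
  ∑ r with l ∈ N.links r, x r

/-- The Lagrangian `φ(x, y) = ∑ᵢ Uᵢ(∑_{r_j ∼ s_i} x_j) + yᵀ(C - A x)`. -/
def lagrangian (N : MultipathNetwork S R L) (U : S → ℝ → ℝ) (x : R → ℝ) (y : L → ℝ) : ℝ :=
  ∑ s, U s (N.sourceRate x s) + y ⬝ᵥ (N.capacity - N.linkMatrix *ᵥ x)

/-- `(x₀, y₀)` is a saddle point of the Lagrangian under the positivity constraints
`x ≥ 0`, `y ≥ 0` (the Lagrangian is maximised in `x` and minimised in `y`). -/
def IsSaddlePoint (N : MultipathNetwork S R L) (U : S → ℝ → ℝ)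
    (x₀ : R → ℝ) (y₀ : L → ℝ) : Prop :=
  0 ≤ x₀ ∧ 0 ≤ y₀ ∧
  (∀ x : R → ℝ, 0 ≤ x → N.lagrangian U x y₀ ≤ N.lagrangian U x₀ y₀) ∧
  (∀ y : L → ℝ, 0 ≤ y → N.lagrangian U x₀ y₀ ≤ N.lagrangian U x₀ y)

/-- The right-hand side of the primal-dual subgradient dynamics, at the state `z = (x, y)`.
The utilities live on `[0, ∞)`, so their derivative at `0` is the one-sided one. -/
noncomputable def subgradientField (N : MultipathNetwork S R L) (U : S → ℝ → ℝ)
    (z : EuclideanSpace ℝ (R ⊕ L)) : EuclideanSpace ℝ (R ⊕ L) :=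
  WithLp.toLp 2 (Sum.elim
    (fun r => posProj
      (derivWithin (U (N.source r)) (Ici 0) (N.sourceRate (fun r' => z (Sum.inl r')) (N.source r))
        - ∑ l ∈ N.links r, z (Sum.inr l))
      (z (Sum.inl r)))
    (fun l => posProj
      (N.linkLoad (fun r' => z (Sum.inl r')) l - N.capacity l)
      (z (Sum.inr l))))

end MultipathNetwork

/-- The nonnegative orthant, with the Euclidean metric. -/
def nonnegOrthant (ι : Type*) : Set (EuclideanSpace ℝ ι) := {z | ∀ i, 0 ≤ z i}

/-- `z`, on the time interval `[0, ∞)`, is a Carathéodory solution of `ż = v(z)`: it is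
absolutely continuous on compact intervals and, at almost all times, differentiable with
derivative `v (z t)`. -/
def IsCaratheodorySolution {ι : Type*} [Fintype ι]
    (v : EuclideanSpace ℝ ι → EuclideanSpace ℝ ι) (z : ℝ → EuclideanSpace ℝ ι) : Prop :=
  (∀ T : ℝ, 0 ≤ T → AbsolutelyContinuousOnInterval z 0 T) ∧
  ∀ᵐ t ∂(volume.restrict (Ioi (0 : ℝ))), HasDerivAt z (v (z t)) t

/-- The semi-flow `Φ` on `K` consists of the Carathéodory solutions of `ż = v(z)` in `K`: its
trajectories are such solutions, and every such solution is one of its trajectories. -/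
def IsCaratheodorySemiflow {ι : Type*} [Fintype ι] {K : Set (EuclideanSpace ℝ ι)}
    (v : EuclideanSpace ℝ ι → EuclideanSpace ℝ ι) (Φ : Flow ℝ≥0 K) : Prop :=
  (∀ p : K, IsCaratheodorySolution v (fun t => (Φ t.toNNReal p : EuclideanSpace ℝ ι))) ∧
  (∀ (p : K) (z : ℝ → EuclideanSpace ℝ ι), z 0 = p → (∀ t, 0 ≤ t → z t ∈ K) →
    IsCaratheodorySolution v z → ∀ t : ℝ≥0, z t = Φ t p)

/-- The equilibrium points of a semi-flow. -/
def equilibriumSet {X : Type*} [TopologicalSpace X] (Φ : Flow ℝ≥0 X) : Set X :=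
  {p | ∀ t, Φ t p = p}

/-- A semi-flow is globally convergent if the distance of every trajectory from the set of
equilibrium points tends to `0` (the distance being `∞` if there are none). -/
def GloballyConvergent {X : Type*} [PseudoEMetricSpace X] (Φ : Flow ℝ≥0 X) : Prop :=
  ∀ p : X, Tendsto (fun t : ℝ≥0 => Metric.infEDist (Φ t p) (equilibriumSet Φ)) atTop (𝓝 0)

/-! The unprojected field is minus a monotone operator: when the difference of two states is paired
with the difference of the fields there, the terms in A and Aᵀ cancel and only the decreasing
marginal utilities remain (`inner_saddleField`). The positive projection can only lower this pairing
(`inner_projectedField_le`). So two solutions never move apart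
(`IsCaratheodorySolution.antitoneOn_dist`), which yields uniqueness and continuous dependence. For a
Lipschitz field, existence follows by Skorokhod reflection of each coordinate at 0 and a contraction
argument in an exponentially weighted norm; the marginal utilities are made Lipschitz by truncation,
which goes unnoticed because solutions stay in a ball around the saddle point e, a zero of the
field.

Sufficiency is a LaSalle argument. The distance to e decreases to a limit, so it is constant along
the orbit of any limit point. Constancy, strict concavity and the positivity of e force the source
rates to agree with those of e and the projection to be inactive
(`projectedField_eq_of_inner_eq_zero`). In coordinates centred at e the orbit then solves x' = -Aᵀy,
y' = Ax with Hx = 0. Differentiating this constraint repeatedly puts every (AᵀA)^j x in ker H, and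
the spectral theorem turns the absence of eigenvectors into Ax = 0 and Aᵀy = 0
(`Matrix.eq_zero_of_unobservable_flow`). Limit points are therefore equilibria, and by
nonexpansiveness the whole trajectory converges to one of them.

Necessity: an eigenvector u in ker H with eigenvalue ω² > 0 gives a small harmonic oscillation
around e that stays in the open orthant, leaves all source rates unchanged and so solves the full
dynamics. A periodic point of a globally convergent semi-flow is an equilibrium, but this one moves.
-/

set_option linter.unusedSectionVars false

/-! ### Contraction between solutions of monotone projected fields -/

/-- The projection only raises a coordinate of the field, and only where the state is 0, hence not
above the other state; the raise is paired with a nonpositive difference. -/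
theorem posProj_sub_mul_le {a b x y : ℝ} (hx : 0 ≤ x) (hy : 0 ≤ y) :
    (posProj a x - posProj b y) * (x - y) ≤ (a - b) * (x - y) := by
  unfold posProj
  rcases hx.eq_or_lt with rfl | hx' <;> rcases hy.eq_or_lt with rfl | hy'
  · simp
  · simp only [lt_irrefl, if_false, hy', if_true]
    nlinarith [le_max_left a 0]
  · simp only [lt_irrefl, if_false, hx', if_true]
    nlinarith [le_max_left b 0]
  · simp [hx', hy']

theorem LipschitzWith.comp_absolutelyContinuousOnInterval {X Y : Type*} [PseudoMetricSpace X]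
    [PseudoMetricSpace Y] {g : X → Y} {K : ℝ≥0} (hg : LipschitzWith K g) {f : ℝ → X} {a b : ℝ}
    (hf : AbsolutelyContinuousOnInterval f a b) :
    AbsolutelyContinuousOnInterval (g ∘ f) a b := by
  have h : Tendsto _ _ (𝓝 ((K : ℝ) * 0)) := Tendsto.const_mul (K : ℝ) hf
  rw [mul_zero] at h
  refine squeeze_zero (fun _ => Finset.sum_nonneg fun _ _ => dist_nonneg) (fun E => ?_) h
  rw [Finset.mul_sum]
  exact Finset.sum_le_sum fun i _ => hg.dist_le_mul _ _

theorem antitoneOn_of_absolutelyContinuous {f : ℝ → ℝ}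
    (hf : ∀ T, 0 ≤ T → AbsolutelyContinuousOnInterval f 0 T)
    (hd : ∀ᵐ t ∂(volume.restrict (Ioi (0 : ℝ))), deriv f t ≤ 0) : AntitoneOn f (Ici 0) := by
  intro a ha b hb hab
  have ha' : (0 : ℝ) ≤ a := ha
  have hac : AbsolutelyContinuousOnInterval f a b :=
    (hf b (ha'.trans hab)).mono (by
      rw [uIcc_of_le hab, uIcc_of_le (ha'.trans hab)]; exact Icc_subset_Icc_left ha')
  have h1 := hac.integral_deriv_eq_sub
  have h2 : ∫ x in a..b, deriv f x ≤ 0 := by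
    rw [intervalIntegral.integral_of_le hab]
    refine integral_nonpos_of_ae ?_
    exact ae_mono (Measure.restrict_mono
      (fun x hx => lt_of_le_of_lt ha' hx.1) le_rfl) hd
  linarith

/-- The field whose coordinates are the positive projections of those of `f`. -/
noncomputable def projectedField {ι : Type*} (f : EuclideanSpace ℝ ι → EuclideanSpace ℝ ι)
    (z : EuclideanSpace ℝ ι) : EuclideanSpace ℝ ι :=
  WithLp.toLp 2 fun i => posProj (f z i) (z i)

/-- Almost everywhere the derivative of ‖z - w‖² is twice the pairing in `hv`, and absolute
continuity integrates its sign. The square is used because the norm is not differentiable at 0. -/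
theorem IsCaratheodorySolution.antitoneOn_dist {ι : Type*} [Fintype ι]
    {v : EuclideanSpace ℝ ι → EuclideanSpace ℝ ι} {K : Set (EuclideanSpace ℝ ι)}
    (hv : ∀ p ∈ K, ∀ q ∈ K, inner ℝ (p - q) (v p - v q) ≤ 0)
    {z w : ℝ → EuclideanSpace ℝ ι} (hz : IsCaratheodorySolution v z)
    (hw : IsCaratheodorySolution v w) (hzK : ∀ t, 0 ≤ t → z t ∈ K) (hwK : ∀ t, 0 ≤ t → w t ∈ K) :
    AntitoneOn (fun t => dist (z t) (w t)) (Ici 0) := by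
  have hsq : AntitoneOn (fun t => ‖z t - w t‖ * ‖z t - w t‖) (Ici 0) := by
    refine antitoneOn_of_absolutelyContinuous (fun T hT => ?_) ?_
    · have h := lipschitzWith_one_norm.comp_absolutelyContinuousOnInterval
        ((hz.1 T hT).sub (hw.1 T hT))
      exact h.mul h
    · filter_upwards [hz.2, hw.2, ae_restrict_mem measurableSet_Ioi] with t h1 h2 ht
      have h3 := (h1.sub h2).norm_sq
      have h4 : (fun t => ‖z t - w t‖ * ‖z t - w t‖) = fun t => ‖(z - w) t‖ ^ 2 := by
        ext t; simp [sq]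
      rw [h4, h3.deriv]
      have := hv _ (hzK t (le_of_lt ht)) _ (hwK t (le_of_lt ht))
      simp only [Pi.sub_apply]
      linarith
  intro a ha b hb hab
  have := hsq ha hb hab
  simp only [dist_eq_norm]
  exact le_of_sq_le_sq (by simpa [sq] using this) (norm_nonneg _)

theorem inner_projectedField_le {ι : Type*} [Fintype ι]
    (f : EuclideanSpace ℝ ι → EuclideanSpace ℝ ι) {p q : EuclideanSpace ℝ ι}
    (hp : p ∈ nonnegOrthant ι) (hq : q ∈ nonnegOrthant ι) :
    inner ℝ (p - q) (projectedField f p - projectedField f q) ≤ inner ℝ (p - q) (f p - f q) := by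
  simp only [PiLp.inner_apply, projectedField]
  refine Finset.sum_le_sum fun i _ => ?_
  simpa using posProj_sub_mul_le (a := f p i) (b := f q i) (hp i) (hq i)

/-! ### From existence and contraction to a semi-flow -/

theorem AbsolutelyContinuousOnInterval.comp_add_right {X : Type*} [PseudoMetricSpace X]
    {f : ℝ → X} {a b c : ℝ} (hf : AbsolutelyContinuousOnInterval f (a + c) (b + c)) :
    AbsolutelyContinuousOnInterval (fun t => f (t + c)) a b := by
  rw [absolutelyContinuousOnInterval_iff] at hf ⊢
  intro ε hε
  obtain ⟨δ, hδ, h⟩ := hf ε hε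
  refine ⟨δ, hδ, fun E hE hlt => ?_⟩
  refine h (E.1, fun i => ((E.2 i).1 + c, (E.2 i).2 + c)) ⟨fun i hi => ?_, ?_⟩ (by simpa using hlt)
  · have := hE.1 i hi
    rw [← image_add_const_uIcc]
    exact ⟨mem_image_of_mem _ this.1, mem_image_of_mem _ this.2⟩
  · intro i hi j hj hij
    have h2 := hE.2 hi hj hij
    have h3 : ∀ x y : ℝ, uIoc (x + c) (y + c) = (fun u => u + c) '' uIoc x y := fun x y => by
      simp [uIoc, max_add_add_right, min_add_add_right]
    simp only [Function.onFun, h3]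
    exact (disjoint_image_iff (add_left_injective c)).2 h2

theorem AbsolutelyContinuousOnInterval.congr {X : Type*} [PseudoMetricSpace X]
    {f g : ℝ → X} {a b : ℝ} (hf : AbsolutelyContinuousOnInterval f a b)
    (h : EqOn f g (uIcc a b)) : AbsolutelyContinuousOnInterval g a b := by
  refine Tendsto.congr' ?_ hf
  rw [EventuallyEq, eventually_inf_principal]
  refine Eventually.of_forall fun E hE => Finset.sum_congr rfl fun i hi => ?_
  rw [h (hE.1 i hi).1, h (hE.1 i hi).2]

theorem IsCaratheodorySolution.shift {ι : Type*} [Fintype ι]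
    {v : EuclideanSpace ℝ ι → EuclideanSpace ℝ ι} {z : ℝ → EuclideanSpace ℝ ι}
    (hz : IsCaratheodorySolution v z) {a : ℝ} (ha : 0 ≤ a) :
    IsCaratheodorySolution v (fun t => z (t + a)) := by
  refine ⟨fun T hT => ?_, ?_⟩
  · refine AbsolutelyContinuousOnInterval.comp_add_right ((hz.1 (T + a) (by positivity)).mono ?_)
    rw [uIcc_of_le (by linarith), uIcc_of_le (by linarith)]
    exact Icc_subset_Icc_left (by linarith)
  · have h := hz.2
    rw [ae_restrict_iff' measurableSet_Ioi] at h ⊢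
    have h2 := (measurePreserving_add_right volume a).quasiMeasurePreserving.ae h
    filter_upwards [h2] with t ht htpos
    have h3 := ht (show (0 : ℝ) < t + a by have : (0 : ℝ) < t := htpos; linarith)
    exact HasDerivAt.comp_add_const t a h3

theorem IsCaratheodorySolution.continuousOn {ι : Type*} [Fintype ι]
    {v : EuclideanSpace ℝ ι → EuclideanSpace ℝ ι} {z : ℝ → EuclideanSpace ℝ ι}
    (hz : IsCaratheodorySolution v z) : ContinuousOn z (Ici 0) := by
  intro t ht
  have ht' : (0 : ℝ) ≤ t := ht
  have h := (hz.1 (t + 1) (by positivity)).continuousOn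
  rw [uIcc_of_le (by positivity)] at h
  refine (h t ⟨ht, by linarith⟩).mono_of_mem_nhdsWithin ?_
  rw [mem_nhdsWithin]
  exact ⟨Iio (t + 1), isOpen_Iio, by simp, fun x hx => ⟨hx.2, le_of_lt hx.1⟩⟩

/-- Contraction from equal starting points is uniqueness, and uniqueness applied to shifted
solutions is the semigroup law. Joint continuity combines contraction in the initial point with
continuity of one trajectory in time. -/
theorem exists_semiflow {ι : Type*} [Fintype ι] {K : Set (EuclideanSpace ℝ ι)}
    {v : EuclideanSpace ℝ ι → EuclideanSpace ℝ ι}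
    (hv : ∀ p ∈ K, ∀ q ∈ K, inner ℝ (p - q) (v p - v q) ≤ 0)
    (hex : ∀ p ∈ K, ∃ z : ℝ → EuclideanSpace ℝ ι, z 0 = p ∧ (∀ t, 0 ≤ t → z t ∈ K) ∧
      IsCaratheodorySolution v z) :
    ∃ Φ : Flow ℝ≥0 K, IsCaratheodorySemiflow v Φ ∧
      ∀ p q, Antitone fun t => dist (Φ t p) (Φ t q) := by
  choose z hz0 hzK hz using fun p : K => hex p p.2
  have huniq : ∀ (p : K) (w : ℝ → EuclideanSpace ℝ ι), w 0 = p → (∀ t, 0 ≤ t → w t ∈ K) →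
      IsCaratheodorySolution v w → ∀ t, 0 ≤ t → w t = z p t := by
    intro p w hw0 hwK hw t ht
    have h := hw.antitoneOn_dist hv (hz p) hwK (hzK p) (self_mem_Ici) ht ht
    simp only [hw0, hz0, dist_self] at h
    exact dist_le_zero.1 h
  have hanti : ∀ p q : K, AntitoneOn (fun t => dist (z p t) (z q t)) (Ici 0) := fun p q =>
    (hz p).antitoneOn_dist hv (hz q) (hzK p) (hzK q)
  let Φ : Flow ℝ≥0 K :=
    { toFun := fun t p => ⟨z p t, hzK p t t.2⟩
      cont' := by
        rw [continuous_iff_continuousAt]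
        rintro ⟨t, p⟩
        rw [ContinuousAt, tendsto_iff_dist_tendsto_zero]
        have h1 : Tendsto (fun y : ℝ≥0 × K => dist y.2 p + dist (z p y.1) (z p t)) (𝓝 (t, p))
            (𝓝 0) := by
          have hc : Continuous fun s : ℝ≥0 => z p s :=
            (hz p).continuousOn.comp_continuous NNReal.continuous_coe fun s => s.2
          have : Continuous fun y : ℝ≥0 × K => dist y.2 p + dist (z p y.1) (z p t) :=
            (continuous_snd.dist continuous_const).add
              ((hc.comp continuous_fst).dist continuous_const)
          have h := this.tendsto (t, p)
          simpa using h
        refine squeeze_zero (fun _ => dist_nonneg) (fun y => ?_) h1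
        have h2 : dist (z y.2 y.1) (z p y.1) ≤ dist y.2 p := by
          have := hanti y.2 p self_mem_Ici (show (y.1 : ℝ) ∈ Ici 0 from y.1.2) y.1.2
          simpa [hz0, Subtype.dist_eq] using this
        exact (dist_triangle _ (z p y.1) _).trans (add_le_add_left h2 _)
      map_add' := by
        intro t s p
        refine Subtype.ext ?_
        have := huniq ⟨z p s, hzK p s s.2⟩ (fun r => z p (r + s)) (by simp)
          (fun r hr => hzK p _ (add_nonneg hr s.2)) ((hz p).shift s.2) t t.2
        simpa using this
      map_zero' := fun p => Subtype.ext (by simpa using hz0 p) }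
  refine ⟨Φ, ⟨fun p => ?_, fun p w hw0 hwK hw t => huniq p w hw0 hwK hw t t.2⟩, fun p q s t hst =>
    hanti p q s.2 t.2 hst⟩
  refine ⟨fun T hT => ?_, ?_⟩
  · refine ((hz p).1 T hT).congr ?_
    intro t ht
    rw [uIcc_of_le hT] at ht
    show z p t = z p t.toNNReal
    rw [Real.coe_toNNReal _ ht.1]
  · filter_upwards [(hz p).2, ae_restrict_mem measurableSet_Ioi] with t h ht
    have ht' : (0 : ℝ) < t := ht
    have h1 : (Φ t.toNNReal p : EuclideanSpace ℝ ι) = z p t := by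
      show z p t.toNNReal = z p t
      rw [Real.coe_toNNReal _ ht'.le]
    rw [h1]
    refine h.congr_of_eventuallyEq ?_
    filter_upwards [Ioi_mem_nhds ht'] with s hs
    show z p s.toNNReal = z p s
    rw [Real.coe_toNNReal _ (le_of_lt hs)]

/-! ### Convergence of nonexpansive semi-flows -/

/-- LaSalle's principle with the distance to e as Lyapunov function. Once a limit point p is known
to be an equilibrium, the distance to p is itself nonincreasing, so convergence along a subsequence
becomes full convergence. -/
theorem globallyConvergent_of_nonexpansive {X : Type*} [MetricSpace X] [ProperSpace X]
    (Φ : Flow ℝ≥0 X) (hΦ : ∀ p q, Antitone fun t => dist (Φ t p) (Φ t q)) {e : X}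
    (he : e ∈ equilibriumSet Φ)
    (h : ∀ p, (∀ s, dist (Φ s p) e = dist p e) → p ∈ equilibriumSet Φ) :
    GloballyConvergent Φ := by
  intro x
  have hanti : Antitone fun t => dist (Φ t x) e := by simpa only [he _] using hΦ x e
  obtain ⟨d, hd⟩ : ∃ d, Tendsto (fun t => dist (Φ t x) e) atTop (𝓝 d) :=
    ⟨_, tendsto_atTop_ciInf hanti ⟨0, by rintro _ ⟨t, rfl⟩; exact dist_nonneg⟩⟩
  have hmem : ∀ n : ℕ, Φ (n : ℝ≥0) x ∈ Metric.closedBall e (dist x e) := fun n => by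
    have := hanti (zero_le : (0 : ℝ≥0) ≤ n)
    simpa using this
  obtain ⟨p, -, φ, hφ, hp⟩ := (isCompact_closedBall e (dist x e)).tendsto_subseq hmem
  have hn : Tendsto (fun n => ((φ n : ℕ) : ℝ≥0)) atTop atTop :=
    tendsto_natCast_atTop_atTop.comp hφ.tendsto_atTop
  -- Both values are limits of the distance to e at the times s + φ n: one by continuity of the
  -- flow, the other by convergence of that distance.
  have hconst : ∀ s, dist (Φ s p) e = d := fun s => by
    have h1 : Tendsto (fun n => dist (Φ s (Φ (φ n : ℝ≥0) x)) e) atTop (𝓝 (dist (Φ s p) e)) :=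
      (((Φ.continuous_toFun s).tendsto p).comp hp).dist tendsto_const_nhds
    have h2 : Tendsto (fun n => dist (Φ s (Φ (φ n : ℝ≥0) x)) e) atTop (𝓝 d) := by
      have h3 : Tendsto (fun n => s + ((φ n : ℕ) : ℝ≥0)) atTop atTop :=
        tendsto_atTop_mono (fun n => le_add_self) hn
      exact (hd.comp h3).congr fun n => congrArg (dist · e) (Φ.map_add _ _ _)
    exact tendsto_nhds_unique h1 h2
  have hpe : p ∈ equilibriumSet Φ := h p fun s => by
    rw [hconst s, ← hconst 0, Φ.map_zero_apply]
  have hanti' : Antitone fun t => edist (Φ t x) p := fun s t hst => by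
    simp only [edist_dist]
    exact ENNReal.ofReal_le_ofReal (by simpa only [hpe _] using hΦ x p hst)
  have hlim : Tendsto (fun t => edist (Φ t x) p) atTop (𝓝 0) := by
    rw [tendsto_iff_edist_tendsto_0] at hp
    have h1 := tendsto_atTop_iInf hanti'
    have h2 := tendsto_nhds_unique (h1.comp hn) hp
    rwa [h2] at h1
  exact tendsto_of_tendsto_of_tendsto_of_le_of_le tendsto_const_nhds hlim (fun _ => zero_le)
    fun t => Metric.infEDist_le_edist_of_mem hpe

/-! ### Skorokhod reflection at 0 -/

/-- The regulator of the Skorokhod reflection at `0` of `w`: the least nondecreasing nonnegative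
function that keeps `w + regulator w` nonnegative. -/
noncomputable def regulator (w : ℝ → ℝ) (t : ℝ) : ℝ := sSup ((fun s => max 0 (-w s)) '' Icc 0 t)

theorem regulator_nonneg (w : ℝ → ℝ) (t : ℝ) : 0 ≤ regulator w t :=
  Real.sSup_nonneg (by rintro _ ⟨s, -, rfl⟩; exact le_max_left _ _)

theorem regulator_le {w : ℝ → ℝ} {t b : ℝ} (hb : 0 ≤ b) (h : ∀ s ∈ Icc 0 t, -w s ≤ b) :
    regulator w t ≤ b :=
  Real.sSup_le (by rintro _ ⟨s, hs, rfl⟩; exact max_le hb (h s hs)) hb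

theorem neg_le_regulator {w : ℝ → ℝ} (hw : Continuous w) {s t : ℝ} (hs : s ∈ Icc 0 t) :
    -w s ≤ regulator w t :=
  (le_max_right _ _).trans (le_csSup
    ((isCompact_Icc.image (by fun_prop : Continuous fun s => max 0 (-w s))).bddAbove)
    (mem_image_of_mem _ hs))

theorem monotone_regulator {w : ℝ → ℝ} (hw : Continuous w) : Monotone (regulator w) :=
  fun _ _ hst => regulator_le (regulator_nonneg _ _) fun _ hr =>
    neg_le_regulator hw ⟨hr.1, hr.2.trans hst⟩

theorem regulator_zero {w : ℝ → ℝ} (h : 0 ≤ w 0) : regulator w 0 = 0 := by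
  simp [regulator, h]

theorem regulator_le_add {w v : ℝ → ℝ} (hw : Continuous w) {t δ : ℝ} (hδ : 0 ≤ δ)
    (h : ∀ s ∈ Icc 0 t, |w s - v s| ≤ δ) : regulator v t ≤ regulator w t + δ :=
  regulator_le (add_nonneg (regulator_nonneg _ _) hδ) fun s hs => by
    have := (abs_le.1 (h s hs)).2
    have := neg_le_regulator hw hs
    linarith

/-- A running supremum is nonexpansive in the sup norm. Together with the path itself, this makes
the reflection 2-Lipschitz. -/
theorem abs_regulator_sub_le {w v : ℝ → ℝ} (hw : Continuous w) (hv : Continuous v) {t δ : ℝ}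
    (hδ : 0 ≤ δ) (h : ∀ s ∈ Icc 0 t, |w s - v s| ≤ δ) :
    |regulator w t - regulator v t| ≤ δ := by
  have h1 := regulator_le_add hw hδ h
  have h2 := regulator_le_add hv hδ fun s hs => by rw [abs_sub_comm]; exact h s hs
  rw [abs_le]; constructor <;> linarith

/-- Between s and t, the new values of -w exceed -w s, hence the regulator at s, by at most M (t -
s). Reflected paths thus stay absolutely continuous. -/
theorem LipschitzOnWith.regulator {w : ℝ → ℝ} (hw : Continuous w) {M : ℝ≥0} {T : ℝ}
    (h : LipschitzOnWith M w (Icc 0 T)) : LipschitzOnWith M (regulator w) (Icc 0 T) := by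
  have key : ∀ s ∈ Icc 0 T, ∀ t ∈ Icc 0 T, s ≤ t →
      _root_.regulator w t ≤ _root_.regulator w s + M * (t - s) := by
    intro s hs t ht hst
    have hM : 0 ≤ M * (t - s) := mul_nonneg M.2 (by linarith)
    refine regulator_le (add_nonneg (regulator_nonneg _ _) hM) fun r hr => ?_
    rcases le_total r s with hrs | hrs
    · have := neg_le_regulator hw (show r ∈ Icc 0 s from ⟨hr.1, hrs⟩)
      linarith
    · have h1 := neg_le_regulator hw (show s ∈ Icc 0 s from ⟨hs.1, le_rfl⟩)
      have h2 := h.dist_le_mul s hs r ⟨hr.1, hr.2.trans ht.2⟩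
      rw [Real.dist_eq, Real.dist_eq, abs_sub_comm s r, abs_of_nonneg (by linarith : 0 ≤ r - s)]
        at h2
      have h3 := (abs_le.1 h2).2
      have h4 : M * (r - s) ≤ M * (t - s) :=
        mul_le_mul_of_nonneg_left (by linarith [hr.2]) M.2
      linarith
  refine LipschitzOnWith.of_dist_le_mul fun s hs t ht => ?_
  rw [Real.dist_eq, Real.dist_eq]
  rcases le_total s t with hst | hst
  · rw [abs_sub_comm, abs_sub_comm s t, abs_of_nonneg (sub_nonneg.2 (monotone_regulator hw hst)),
      abs_of_nonneg (sub_nonneg.2 hst)]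
    linarith [key s hs t ht hst]
  · rw [abs_of_nonneg (sub_nonneg.2 (monotone_regulator hw hst)),
      abs_of_nonneg (sub_nonneg.2 hst)]
    linarith [key t ht s hs hst]

theorem ContDiff.exists_lipschitzOnWith_regulator {w : ℝ → ℝ} (hw : ContDiff ℝ 1 w) (T : ℝ) :
    ∃ M, LipschitzOnWith M (regulator w) (Icc 0 T) := by
  obtain ⟨M, hM⟩ := hw.contDiffOn.exists_lipschitzOnWith one_ne_zero (convex_Icc 0 T) isCompact_Icc
  exact ⟨M, hM.regulator hw.continuous⟩

theorem ContDiff.continuousOn_regulator {w : ℝ → ℝ} (hw : ContDiff ℝ 1 w) :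
    ContinuousOn (regulator w) (Ici 0) := by
  intro t ht
  have ht' : (0 : ℝ) ≤ t := ht
  obtain ⟨M, hM⟩ := hw.exists_lipschitzOnWith_regulator (t + 1)
  refine (hM.continuousOn t ⟨ht, by linarith⟩).mono_of_mem_nhdsWithin ?_
  rw [mem_nhdsWithin]
  exact ⟨Iio (t + 1), isOpen_Iio, by simp, fun x hx => ⟨hx.2, le_of_lt hx.1⟩⟩

theorem reflection_nonneg {w : ℝ → ℝ} (hw : Continuous w) {t : ℝ} (ht : 0 ≤ t) :
    0 ≤ w t + regulator w t := by
  linarith [neg_le_regulator hw (show t ∈ Icc 0 t from ⟨ht, le_rfl⟩)]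

/-- At almost all times the reflection of `w` moves with the positive projection of `w'`. -/
theorem hasDerivAt_reflection {w : ℝ → ℝ} (hw : Continuous w) {t a : ℝ} (ht : 0 < t)
    (hwt : HasDerivAt w a t) (hl : DifferentiableAt ℝ (regulator w) t) :
    HasDerivAt (fun s => w s + regulator w s) (posProj a (w t + regulator w t)) t := by
  have hsum := hwt.add hl.hasDerivAt
  have hl0 : 0 ≤ deriv (regulator w) t := (monotone_regulator hw).deriv_nonneg
  suffices h : posProj a (w t + regulator w t) = a + deriv (regulator w) t by rw [h]; exact hsum
  unfold posProj
  split_ifs with hpos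
  -- While the reflected path is positive, -w stays strictly below the running supremum near t, so
  -- the regulator is constant just after t; a right derivative is enough to identify its
  -- derivative.
  · have hev : ∀ᶠ s in 𝓝[>] t, regulator w s = regulator w t := by
      obtain ⟨δ, hδ, hδ'⟩ := Metric.continuousAt_iff.1 (hw.continuousAt (x := t)) _ hpos
      filter_upwards [Ioo_mem_nhdsGT (show t < t + δ by linarith)] with s hs
      refine le_antisymm ?_ (monotone_regulator hw hs.1.le)
      refine regulator_le (regulator_nonneg _ _) fun r hr => ?_
      rcases le_total r t with hrt | hrt
      · exact neg_le_regulator hw ⟨hr.1, hrt⟩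
      · have := @hδ' r (by rw [Real.dist_eq, abs_of_nonneg (by linarith)]; linarith [hr.2, hs.2])
        rw [Real.dist_eq] at this
        linarith [(abs_lt.1 this).1]
    have h0 : HasDerivWithinAt (regulator w) 0 (Ioi t) t :=
      (hasDerivWithinAt_const t (Ioi t) (regulator w t)).congr_of_eventuallyEq hev rfl
    have := (uniqueDiffWithinAt_Ioi t).eq_deriv _ hl.hasDerivAt.hasDerivWithinAt h0
    rw [this, add_zero]
  · have hz : w t + regulator w t = 0 := le_antisymm (not_lt.1 hpos) (reflection_nonneg hw ht.le)
    -- The reflected path is nonnegative and vanishes at t, so its derivative is 0 there; then a is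
    -- minus the nonnegative slope of the regulator, and the projection of a is 0.
    have hmin : IsLocalMin (fun s => w s + regulator w s) t := by
      filter_upwards [Ioi_mem_nhds ht] with s hs
      rw [hz]
      exact reflection_nonneg hw (le_of_lt hs)
    have h0 : a + deriv (regulator w) t = 0 := hmin.hasDerivAt_eq_zero hsum
    rw [h0, max_eq_right (by linarith)]

/-! ### Picard iteration for the reflected equation on the half-line -/

/-- Integration gains a factor 1 / lam against the weight exp (lam t); this is what makes the Picard
map contract on all of [0, ∞) at once. -/
theorem norm_integral_le_exp {E : Type*} [NormedAddCommGroup E] [NormedSpace ℝ E] {G : ℝ → E}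
    {b lam t : ℝ} (hlam : 0 < lam) (hb : 0 ≤ b) (ht : 0 ≤ t)
    (hG : ∀ s, 0 ≤ s → ‖G s‖ ≤ b * Real.exp (lam * s)) :
    ‖∫ s in (0 : ℝ)..t, G s‖ ≤ b / lam * Real.exp (lam * t) := by
  have h1 : ‖∫ s in (0 : ℝ)..t, G s‖ ≤ ∫ s in (0 : ℝ)..t, b * Real.exp (lam * s) :=
    intervalIntegral.norm_integral_le_of_norm_le ht
      (by filter_upwards with s hs using hG s hs.1.le)
      (Continuous.intervalIntegrable (by fun_prop) _ _)
  have h2 : ∫ s in (0 : ℝ)..t, b * Real.exp (lam * s)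
      = b / lam * Real.exp (lam * t) - b / lam * Real.exp (lam * 0) := by
    refine intervalIntegral.integral_eq_sub_of_hasDerivAt
      (f := fun s => b / lam * Real.exp (lam * s)) (fun s _ => ?_)
      (Continuous.intervalIntegrable (by fun_prop) _ _)
    refine ((((hasDerivAt_id' s).const_mul lam).exp).const_mul (b / lam)).congr_deriv ?_
    field_simp
  have h3 : 0 ≤ b / lam * Real.exp (lam * 0) := by positivity
  linarith

section Picard

variable {ι : Type*} [Fintype ι]

/-- The path with weighted profile `h`. -/
noncomputable def weightedPath (lam : ℝ) (h : BoundedContinuousFunction ℝ≥0 (ι → ℝ)) (s : ℝ) :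
    ι → ℝ := Real.exp (lam * s) • h s.toNNReal

/-- The primitive of `g` along the weighted path, starting from `p`. -/
noncomputable def weightedDrive (g : (ι → ℝ) → ι → ℝ) (p : ι → ℝ) (lam : ℝ)
    (h : BoundedContinuousFunction ℝ≥0 (ι → ℝ)) (t : ℝ) : ι → ℝ :=
  p + ∫ s in (0 : ℝ)..t, g (weightedPath lam h s)

theorem continuous_weightedPath (lam : ℝ) (h : BoundedContinuousFunction ℝ≥0 (ι → ℝ)) :
    Continuous (weightedPath lam h) := by
  unfold weightedPath
  have := h.continuous
  fun_prop

theorem hasDerivAt_weightedDrive {g : (ι → ℝ) → ι → ℝ} (hg : Continuous g) (p : ι → ℝ) (lam : ℝ)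
    (h : BoundedContinuousFunction ℝ≥0 (ι → ℝ)) (t : ℝ) :
    HasDerivAt (weightedDrive g p lam h) (g (weightedPath lam h t)) t := by
  have hc := hg.comp (continuous_weightedPath lam h)
  exact ((hc.integral_hasStrictDerivAt 0 t).hasDerivAt).const_add p

theorem contDiff_weightedDrive {g : (ι → ℝ) → ι → ℝ} (hg : Continuous g) (p : ι → ℝ) (lam : ℝ)
    (h : BoundedContinuousFunction ℝ≥0 (ι → ℝ)) :
    ContDiff ℝ 1 (weightedDrive g p lam h) := by
  rw [contDiff_one_iff_deriv]
  refine ⟨fun t => (hasDerivAt_weightedDrive hg p lam h t).differentiableAt, ?_⟩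
  have : deriv (weightedDrive g p lam h) = fun t => g (weightedPath lam h t) :=
    funext fun t => (hasDerivAt_weightedDrive hg p lam h t).deriv
  rw [this]
  exact hg.comp (continuous_weightedPath lam h)

theorem contDiff_weightedDrive_apply {g : (ι → ℝ) → ι → ℝ} (hg : Continuous g) (p : ι → ℝ)
    (lam : ℝ) (h : BoundedContinuousFunction ℝ≥0 (ι → ℝ)) (i : ι) :
    ContDiff ℝ 1 (fun t => weightedDrive g p lam h t i) :=
  contDiff_pi.1 (contDiff_weightedDrive hg p lam h) i

/-- The coordinatewise reflection of the drive. -/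
noncomputable def weightedReflection (g : (ι → ℝ) → ι → ℝ) (p : ι → ℝ) (lam : ℝ)
    (h : BoundedContinuousFunction ℝ≥0 (ι → ℝ)) (t : ℝ) : ι → ℝ := fun i =>
  weightedDrive g p lam h t i + regulator (fun s => weightedDrive g p lam h s i) t

theorem norm_weightedPath_le (lam : ℝ) (h : BoundedContinuousFunction ℝ≥0 (ι → ℝ)) (s : ℝ) :
    ‖weightedPath lam h s‖ ≤ ‖h‖ * Real.exp (lam * s) := by
  rw [weightedPath, norm_smul, Real.norm_eq_abs, Real.abs_exp, mul_comm]
  exact mul_le_mul_of_nonneg_right (h.norm_coe_le_norm _) (Real.exp_pos _).le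

theorem norm_weightedPath_sub_le (lam : ℝ) (h k : BoundedContinuousFunction ℝ≥0 (ι → ℝ)) (s : ℝ) :
    ‖weightedPath lam h s - weightedPath lam k s‖ ≤ ‖h - k‖ * Real.exp (lam * s) := by
  have := norm_weightedPath_le lam (h - k) s
  simpa [weightedPath, smul_sub] using this

theorem norm_weightedDrive_le {g : (ι → ℝ) → ι → ℝ} {M : ℝ≥0} (hg : LipschitzWith M g) (p : ι → ℝ)
    {lam : ℝ} (hlam : 0 < lam) (h : BoundedContinuousFunction ℝ≥0 (ι → ℝ)) {t : ℝ} (ht : 0 ≤ t) :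
    ‖weightedDrive g p lam h t‖ ≤ (‖p‖ + (‖g 0‖ + M * ‖h‖) / lam) * Real.exp (lam * t) := by
  have h1 : ‖∫ s in (0 : ℝ)..t, g (weightedPath lam h s)‖
      ≤ (‖g 0‖ + M * ‖h‖) / lam * Real.exp (lam * t) := by
    refine norm_integral_le_exp hlam (by positivity) ht fun s hs => ?_
    have h2 := hg.norm_sub_le (weightedPath lam h s) 0
    have h3 := norm_weightedPath_le lam h s
    have h4 := norm_le_norm_add_norm_sub' (g (weightedPath lam h s)) (g 0)
    have h5 : 1 ≤ Real.exp (lam * s) := Real.one_le_exp (by positivity)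
    rw [sub_zero] at h2
    have h6 : M * ‖weightedPath lam h s‖ ≤ M * (‖h‖ * Real.exp (lam * s)) :=
      mul_le_mul_of_nonneg_left h3 M.2
    have h7 : ‖g 0‖ ≤ ‖g 0‖ * Real.exp (lam * s) := le_mul_of_one_le_right (norm_nonneg _) h5
    linarith
  have h5 : 1 ≤ Real.exp (lam * t) := Real.one_le_exp (by positivity)
  have h7 : ‖p‖ ≤ ‖p‖ * Real.exp (lam * t) := le_mul_of_one_le_right (norm_nonneg _) h5
  have := norm_add_le p (∫ s in (0 : ℝ)..t, g (weightedPath lam h s))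
  unfold weightedDrive
  linarith

theorem norm_weightedDrive_sub_le {g : (ι → ℝ) → ι → ℝ} {M : ℝ≥0} (hg : LipschitzWith M g)
    (p : ι → ℝ) {lam : ℝ} (hlam : 0 < lam) (h k : BoundedContinuousFunction ℝ≥0 (ι → ℝ)) {t : ℝ}
    (ht : 0 ≤ t) :
    ‖weightedDrive g p lam h t - weightedDrive g p lam k t‖
      ≤ M * ‖h - k‖ / lam * Real.exp (lam * t) := by
  have hc : ∀ h, Continuous fun s => g (weightedPath lam h s) := fun h =>
    hg.continuous.comp (continuous_weightedPath lam h)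
  unfold weightedDrive
  rw [add_sub_add_left_eq_sub, ← intervalIntegral.integral_sub ((hc h).intervalIntegrable _ _)
    ((hc k).intervalIntegrable _ _)]
  refine norm_integral_le_exp hlam (by positivity) ht fun s hs => ?_
  refine (hg.norm_sub_le _ _).trans ?_
  rw [mul_assoc]
  exact mul_le_mul_of_nonneg_left (norm_weightedPath_sub_le lam h k s) M.2

theorem norm_weightedReflection_le {g : (ι → ℝ) → ι → ℝ} {M : ℝ≥0} (hg : LipschitzWith M g)
    (p : ι → ℝ) {lam : ℝ} (hlam : 0 < lam) (h : BoundedContinuousFunction ℝ≥0 (ι → ℝ)) {t : ℝ}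
    (ht : 0 ≤ t) :
    ‖weightedReflection g p lam h t‖
      ≤ 2 * ((‖p‖ + (‖g 0‖ + M * ‖h‖) / lam) * Real.exp (lam * t)) := by
  set B := (‖p‖ + (‖g 0‖ + M * ‖h‖) / lam) with hB
  have hB0 : 0 ≤ B := by positivity
  have hbound : ∀ i, ∀ s ∈ Icc 0 t, |weightedDrive g p lam h s i| ≤ B * Real.exp (lam * t) := by
    intro i s hs
    refine ((norm_le_pi_norm _ i).trans (norm_weightedDrive_le hg p hlam h hs.1)).trans ?_
    refine mul_le_mul_of_nonneg_left (Real.exp_le_exp.2 ?_) hB0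
    exact mul_le_mul_of_nonneg_left hs.2 hlam.le
  refine (pi_norm_le_iff_of_nonneg (by positivity)).2 fun i => ?_
  have h1 := hbound i t ⟨ht, le_rfl⟩
  have h2 : regulator (fun s => weightedDrive g p lam h s i) t ≤ B * Real.exp (lam * t) :=
    regulator_le (by positivity) fun s hs => by linarith [(abs_le.1 (hbound i s hs)).1]
  have h3 := regulator_nonneg (fun s => weightedDrive g p lam h s i) t
  simp only [weightedReflection, Real.norm_eq_abs]
  rw [abs_le] at h1 ⊢
  constructor <;> linarith [h1.1, h1.2]

theorem norm_weightedReflection_sub_le {g : (ι → ℝ) → ι → ℝ} {M : ℝ≥0} (hg : LipschitzWith M g)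
    (p : ι → ℝ) {lam : ℝ} (hlam : 0 < lam) (h k : BoundedContinuousFunction ℝ≥0 (ι → ℝ)) {t : ℝ}
    (ht : 0 ≤ t) :
    ‖weightedReflection g p lam h t - weightedReflection g p lam k t‖
      ≤ 2 * (M * ‖h - k‖ / lam * Real.exp (lam * t)) := by
  have hbound : ∀ i, ∀ s ∈ Icc 0 t, |weightedDrive g p lam h s i - weightedDrive g p lam k s i|
      ≤ M * ‖h - k‖ / lam * Real.exp (lam * t) := by
    intro i s hs
    refine ((norm_le_pi_norm (weightedDrive g p lam h s - weightedDrive g p lam k s) i).trans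
      (norm_weightedDrive_sub_le hg p hlam h k hs.1)).trans ?_
    refine mul_le_mul_of_nonneg_left (Real.exp_le_exp.2 ?_) (by positivity)
    exact mul_le_mul_of_nonneg_left hs.2 hlam.le
  refine (pi_norm_le_iff_of_nonneg (by positivity)).2 fun i => ?_
  have h1 := hbound i t ⟨ht, le_rfl⟩
  have h2 := abs_regulator_sub_le
    (contDiff_weightedDrive_apply hg.continuous p lam h i).continuous
    (contDiff_weightedDrive_apply hg.continuous p lam k i).continuous (by positivity) (hbound i)
  simp only [weightedReflection, Real.norm_eq_abs, Pi.sub_apply]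
  rw [add_sub_add_comm]
  exact (abs_add_le _ _).trans (by linarith)

theorem continuousOn_weightedReflection {g : (ι → ℝ) → ι → ℝ} (hg : Continuous g)
    (p : ι → ℝ) (lam : ℝ) (h : BoundedContinuousFunction ℝ≥0 (ι → ℝ)) :
    ContinuousOn (weightedReflection g p lam h) (Ici 0) := by
  refine continuousOn_pi.2 fun i => ?_
  have := contDiff_weightedDrive_apply hg p lam h i
  exact this.continuous.continuousOn.add this.continuousOn_regulator

theorem continuous_exp_smul_weightedReflection {g : (ι → ℝ) → ι → ℝ} (hg : Continuous g)
    (p : ι → ℝ) (lam : ℝ) (h : BoundedContinuousFunction ℝ≥0 (ι → ℝ)) :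
    Continuous fun t : ℝ≥0 => Real.exp (-(lam * t)) • weightedReflection g p lam h t := by
  have h1 : Continuous fun t : ℝ≥0 => weightedReflection g p lam h t :=
    (continuousOn_weightedReflection hg p lam h).comp_continuous
      NNReal.continuous_coe fun t => t.coe_nonneg
  fun_prop

theorem norm_exp_smul_le_iff {x : ι → ℝ} {a b : ℝ} :
    ‖Real.exp (-a) • x‖ ≤ b ↔ ‖x‖ ≤ b * Real.exp a := by
  rw [norm_smul, Real.norm_eq_abs, Real.abs_exp, Real.exp_neg, inv_mul_le_iff₀ (Real.exp_pos _),
    mul_comm]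

/-- The Picard map on weighted profiles. -/
noncomputable def reflectedPicard {g : (ι → ℝ) → ι → ℝ} {M : ℝ≥0} (hg : LipschitzWith M g)
    (p : ι → ℝ) {lam : ℝ} (hlam : 0 < lam) (h : BoundedContinuousFunction ℝ≥0 (ι → ℝ)) :
    BoundedContinuousFunction ℝ≥0 (ι → ℝ) :=
  BoundedContinuousFunction.ofNormedAddCommGroup
    (fun t : ℝ≥0 => Real.exp (-(lam * t)) • weightedReflection g p lam h t)
    (continuous_exp_smul_weightedReflection hg.continuous p lam h)
    (2 * (‖p‖ + (‖g 0‖ + M * ‖h‖) / lam))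
    (fun t => norm_exp_smul_le_iff.2 (by
      rw [mul_assoc]; exact norm_weightedReflection_le hg p hlam h t.coe_nonneg))

theorem reflectedPicard_apply {g : (ι → ℝ) → ι → ℝ} {M : ℝ≥0} (hg : LipschitzWith M g)
    (p : ι → ℝ) {lam : ℝ} (hlam : 0 < lam) (h : BoundedContinuousFunction ℝ≥0 (ι → ℝ)) (t : ℝ≥0) :
    reflectedPicard hg p hlam h t = Real.exp (-(lam * t)) • weightedReflection g p lam h t :=
  rfl

/-- The drive contributes a factor M / lam and the reflection a factor 2, so 4 M ≤ lam leaves at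
most 1/2. -/
theorem contractingWith_reflectedPicard {g : (ι → ℝ) → ι → ℝ} {M : ℝ≥0} (hg : LipschitzWith M g)
    (p : ι → ℝ) {lam : ℝ} (hlam : 0 < lam) (hM : 4 * M ≤ lam) :
    ContractingWith (1 / 2) (reflectedPicard hg p hlam) := by
  refine ⟨by rw [← NNReal.coe_lt_coe]; norm_num, LipschitzWith.of_dist_le_mul fun h k => ?_⟩
  rw [dist_eq_norm, dist_eq_norm]
  refine (BoundedContinuousFunction.norm_le (by positivity)).2 fun t => ?_
  rw [BoundedContinuousFunction.sub_apply, reflectedPicard_apply, reflectedPicard_apply,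
    ← smul_sub, norm_exp_smul_le_iff]
  refine (norm_weightedReflection_sub_le hg p hlam h k t.coe_nonneg).trans ?_
  have h3 : M * ‖h - k‖ / lam ≤ ‖h - k‖ / 4 := by
    rw [div_le_div_iff₀ hlam (by norm_num)]
    nlinarith [norm_nonneg (h - k)]
  have h4 := mul_le_mul_of_nonneg_right h3 (Real.exp_pos (lam * t)).le
  push_cast
  linarith

theorem exists_weightedReflection_eq_weightedPath {g : (ι → ℝ) → ι → ℝ} {M : ℝ≥0}
    (hg : LipschitzWith M g) (p : ι → ℝ) :
    ∃ (lam : ℝ) (h : BoundedContinuousFunction ℝ≥0 (ι → ℝ)),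
      ∀ t, 0 ≤ t → weightedReflection g p lam h t = weightedPath lam h t := by
  -- The summand 1 keeps the rate positive when M = 0.
  have hlam : (0 : ℝ) < 4 * M + 1 := by positivity
  have hF := contractingWith_reflectedPicard hg p hlam (by linarith)
  obtain ⟨h, hh⟩ : ∃ h, reflectedPicard hg p hlam h = h := ⟨_, hF.fixedPoint_isFixedPt⟩
  refine ⟨4 * M + 1, h, fun t ht => ?_⟩
  have h1 := reflectedPicard_apply hg p hlam h t.toNNReal
  rw [hh, Real.coe_toNNReal t ht] at h1
  rw [weightedPath, h1, smul_smul, ← Real.exp_add, add_neg_cancel, Real.exp_zero, one_smul]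

end Picard

/-- The fixed point z is the reflection of p + ∫ f(z). Each regulator is monotone, hence
differentiable almost everywhere, and there `hasDerivAt_reflection` gives the projected equation. -/
theorem exists_caratheodorySolution_of_lipschitz {ι : Type*} [Fintype ι]
    {f : EuclideanSpace ℝ ι → EuclideanSpace ℝ ι} {M : ℝ≥0} (hf : LipschitzWith M f)
    {p : EuclideanSpace ℝ ι} (hp : p ∈ nonnegOrthant ι) :
    ∃ z : ℝ → EuclideanSpace ℝ ι, z 0 = p ∧ (∀ t, 0 ≤ t → z t ∈ nonnegOrthant ι) ∧
      IsCaratheodorySolution (projectedField f) z := by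
  -- Reflection is coordinatewise, so the Picard argument lives in the sup norm; this equivalence
  -- carries it to the Euclidean norm at the cost of a Lipschitz constant.
  let e := PiLp.continuousLinearEquiv 2 ℝ (fun _ : ι => ℝ)
  let g : (ι → ℝ) → ι → ℝ := fun x => e (f (e.symm x))
  have hg : LipschitzWith _ g := e.lipschitz.comp (hf.comp e.symm.lipschitz)
  obtain ⟨lam, h, hh⟩ := exists_weightedReflection_eq_weightedPath hg (e p)
  have hsm := contDiff_weightedDrive_apply hg.continuous (e p) lam h
  refine ⟨fun t => e.symm (weightedReflection g (e p) lam h t), ?_, fun t ht i => ?_,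
    fun T hT => ?_, ?_⟩
  · ext i
    have h0 : weightedDrive g (e p) lam h 0 i = p i := by simp [weightedDrive, e]
    have : regulator (fun s => weightedDrive g (e p) lam h s i) 0 = 0 :=
      regulator_zero (by rw [h0]; exact hp i)
    show weightedDrive g (e p) lam h 0 i + regulator _ 0 = p i
    rw [this, h0, add_zero]
  · exact reflection_nonneg (hsm i).continuous ht
  · have h1 : ∀ i, ∃ C, LipschitzOnWith C (fun t => weightedReflection g (e p) lam h t i)
        (Icc 0 T) := fun i => by
      obtain ⟨C, hC⟩ := (hsm i).contDiffOn.exists_lipschitzOnWith one_ne_zero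
        (convex_Icc 0 T) isCompact_Icc
      exact ⟨_, hC.add (hC.regulator (hsm i).continuous)⟩
    choose C hC using h1
    have h2 : LipschitzOnWith (∑ i, C i) (weightedReflection g (e p) lam h) (Icc 0 T) := by
      refine LipschitzOnWith.of_dist_le_mul fun s hs t ht => ?_
      refine (dist_pi_le_iff (by positivity)).2 fun i => ((hC i).dist_le_mul s hs t ht).trans ?_
      refine mul_le_mul_of_nonneg_right ?_ dist_nonneg
      exact_mod_cast Finset.single_le_sum (fun i _ => zero_le) (Finset.mem_univ i)
    rw [← uIcc_of_le hT] at h2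
    exact e.symm.lipschitz.comp_absolutelyContinuousOnInterval h2.absolutelyContinuousOnInterval
  · have h1 : ∀ᵐ t : ℝ, ∀ i, DifferentiableAt ℝ
        (regulator fun s => weightedDrive g (e p) lam h s i) t :=
      ae_all_iff.2 fun i => (monotone_regulator (hsm i).continuous).ae_differentiableAt
    filter_upwards [ae_restrict_of_ae h1, ae_restrict_mem measurableSet_Ioi] with t h2 ht
    have ht' : (0 : ℝ) < t := ht
    have h3 : HasDerivAt (weightedReflection g (e p) lam h)
        (fun i => posProj (g (weightedPath lam h t) i) (weightedReflection g (e p) lam h t i)) t :=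
      hasDerivAt_pi.2 fun i => hasDerivAt_reflection (hsm i).continuous ht'
        (hasDerivAt_pi.1 (hasDerivAt_weightedDrive hg.continuous (e p) lam h t) i) (h2 i)
    rw [← hh t ht'.le] at h3
    exact e.symm.hasFDerivAt.comp_hasDerivAt t h3

/-! ### Stationary points, and monotonicity and existence for the network field -/

theorem posProj_zero_left (x : ℝ) : posProj 0 x = 0 := by simp [posProj]

theorem posProj_of_pos {a x : ℝ} (hx : 0 < x) : posProj a x = a := by simp [posProj, hx]

theorem projectedField_eq_zero {ι : Type*} {f : EuclideanSpace ℝ ι → EuclideanSpace ℝ ι}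
    {p : EuclideanSpace ℝ ι} (h : f p = 0) : projectedField f p = 0 := by
  ext i
  simp [projectedField, h, posProj_zero_left]

theorem isCaratheodorySolution_const {ι : Type*} [Fintype ι]
    {v : EuclideanSpace ℝ ι → EuclideanSpace ℝ ι} {p : EuclideanSpace ℝ ι} (h : v p = 0) :
    IsCaratheodorySolution v fun _ => p :=
  ⟨fun _ _ => ((LipschitzWith.const' p).lipschitzOnWith (K := 0)).absolutelyContinuousOnInterval,
    by simp only [h]; exact Eventually.of_forall fun t => hasDerivAt_const t p⟩

theorem IsCaratheodorySemiflow.mem_equilibriumSet {ι : Type*} [Fintype ι]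
    {K : Set (EuclideanSpace ℝ ι)} {v : EuclideanSpace ℝ ι → EuclideanSpace ℝ ι} {Φ : Flow ℝ≥0 K}
    (hΦ : IsCaratheodorySemiflow v Φ) {p : K} (h : v p = 0) : p ∈ equilibriumSet Φ := fun t =>
  Subtype.ext (hΦ.2 p (fun _ => p) rfl (fun _ _ => p.2) (isCaratheodorySolution_const h) t).symm

theorem exists_lipschitzWith_euclidean {X ι : Type*} [PseudoMetricSpace X] [Fintype ι]
    {f : X → EuclideanSpace ℝ ι} (h : ∀ i, ∃ C, LipschitzWith C fun x => f x i) :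
    ∃ C, LipschitzWith C f := by
  choose C hC using h
  let e := PiLp.continuousLinearEquiv 2 ℝ (fun _ : ι => ℝ)
  have h2 : LipschitzWith (∑ i, C i) fun x => e (f x) := by
    refine LipschitzWith.of_dist_le_mul fun s t => ?_
    refine (dist_pi_le_iff (by positivity)).2 fun i => ((hC i).dist_le_mul s t).trans ?_
    refine mul_le_mul_of_nonneg_right ?_ dist_nonneg
    exact_mod_cast Finset.single_le_sum (fun i _ => zero_le) (Finset.mem_univ i)
  exact ⟨_, e.symm.lipschitz.comp h2⟩

namespace MultipathNetwork

variable {S R L : Type*} [Fintype S] [Fintype R] [Fintype L] [DecidableEq S] [DecidableEq L]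

/-- The unprojected primal-dual field with marginal utilities `g`. -/
noncomputable def saddleField (N : MultipathNetwork S R L) (g : S → ℝ → ℝ)
    (z : EuclideanSpace ℝ (R ⊕ L)) : EuclideanSpace ℝ (R ⊕ L) :=
  WithLp.toLp 2 (Sum.elim
    (fun r => g (N.source r) (N.sourceRate (fun r' => z (Sum.inl r')) (N.source r))
        - ∑ l ∈ N.links r, z (Sum.inr l))
    (fun l => N.linkLoad (fun r' => z (Sum.inl r')) l - N.capacity l))

theorem subgradientField_eq (N : MultipathNetwork S R L) (U : S → ℝ → ℝ) :
    N.subgradientField U = projectedField (N.saddleField fun s => derivWithin (U s) (Ici 0)) := by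
  ext z i
  cases i <;> rfl

theorem sourceRate_sub (N : MultipathNetwork S R L) (x x' : R → ℝ) (s : S) :
    N.sourceRate (fun r => x r - x' r) s = N.sourceRate x s - N.sourceRate x' s :=
  Finset.sum_sub_distrib _ _

theorem linkLoad_sub (N : MultipathNetwork S R L) (x x' : R → ℝ) (l : L) :
    N.linkLoad (fun r => x r - x' r) l = N.linkLoad x l - N.linkLoad x' l :=
  Finset.sum_sub_distrib _ _

theorem sum_mul_sum_links (N : MultipathNetwork S R L) (x : R → ℝ) (y : L → ℝ) :
    ∑ r, x r * ∑ l ∈ N.links r, y l = ∑ l, N.linkLoad x l * y l := by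
  simp only [linkLoad, Finset.mul_sum, Finset.sum_mul, Finset.sum_filter]
  rw [Finset.sum_comm' (t' := Finset.univ) (s' := fun l => {r | l ∈ N.links r}) (by simp)]
  simp only [Finset.sum_filter, ite_mul, zero_mul]

theorem sum_mul_source (N : MultipathNetwork S R L) (x : R → ℝ) (G : S → ℝ) :
    ∑ r, x r * G (N.source r) = ∑ s, N.sourceRate x s * G s := by
  rw [← Finset.sum_fiberwise Finset.univ N.source]
  refine Finset.sum_congr rfl fun s _ => ?_
  rw [sourceRate, Finset.sum_mul]
  refine Finset.sum_congr rfl fun r hr => ?_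
  rw [(Finset.mem_filter.1 hr).2]

/-- The coupling through the links is skew: prices enter the routes through -Aᵀ and loads enter the
links through A, so both contributions cancel, as do the capacities. -/
theorem inner_saddleField (N : MultipathNetwork S R L) (g : S → ℝ → ℝ)
    (p q : EuclideanSpace ℝ (R ⊕ L)) :
    inner ℝ (p - q) (N.saddleField g p - N.saddleField g q) =
      ∑ s, (N.sourceRate (fun r => p (.inl r)) s - N.sourceRate (fun r => q (.inl r)) s) *
        (g s (N.sourceRate (fun r => p (.inl r)) s) -
          g s (N.sourceRate (fun r => q (.inl r)) s)) := by
  have h1 := N.sum_mul_source (fun r => p (.inl r) - q (.inl r)) fun s =>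
    g s (N.sourceRate (fun r => p (.inl r)) s) - g s (N.sourceRate (fun r => q (.inl r)) s)
  have h2 := N.sum_mul_sum_links (fun r => p (.inl r) - q (.inl r))
    fun l => p (.inr l) - q (.inr l)
  simp only [sourceRate_sub, linkLoad_sub, Finset.sum_sub_distrib] at h1 h2
  rw [← h1, PiLp.inner_apply, Fintype.sum_sum_type]
  have h3 : ∀ l, inner ℝ ((p - q) (.inr l)) ((N.saddleField g p - N.saddleField g q) (.inr l)) =
      (N.linkLoad (fun r => p (.inl r)) l - N.linkLoad (fun r => q (.inl r)) l) *
        (p (.inr l) - q (.inr l)) := fun l => by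
    simp [saddleField]
  rw [Finset.sum_congr rfl fun l _ => h3 l, ← h2, ← Finset.sum_add_distrib]
  refine Finset.sum_congr rfl fun r _ => ?_
  simp [saddleField]
  ring

theorem sourceRate_nonneg (N : MultipathNetwork S R L) {p : EuclideanSpace ℝ (R ⊕ L)}
    (hp : p ∈ nonnegOrthant (R ⊕ L)) (s : S) : 0 ≤ N.sourceRate (fun r => p (.inl r)) s :=
  Finset.sum_nonneg fun r _ => hp (.inl r)

theorem inner_saddleField_nonpos (N : MultipathNetwork S R L) {g : S → ℝ → ℝ}
    (hg : ∀ s, AntitoneOn (g s) (Ici 0)) {p q : EuclideanSpace ℝ (R ⊕ L)}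
    (hp : p ∈ nonnegOrthant (R ⊕ L)) (hq : q ∈ nonnegOrthant (R ⊕ L)) :
    inner ℝ (p - q) (N.saddleField g p - N.saddleField g q) ≤ 0 := by
  rw [inner_saddleField]
  refine Finset.sum_nonpos fun s _ => ?_
  have hp' : N.sourceRate (fun r => p (.inl r)) s ∈ Ici 0 := N.sourceRate_nonneg hp s
  have hq' : N.sourceRate (fun r => q (.inl r)) s ∈ Ici 0 := N.sourceRate_nonneg hq s
  rcases le_total (N.sourceRate (fun r => p (.inl r)) s) (N.sourceRate (fun r => q (.inl r)) s)
    with h | h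
  · exact mul_nonpos_of_nonpos_of_nonneg (by linarith) (by linarith [hg s hp' hq' h])
  · exact mul_nonpos_of_nonneg_of_nonpos (by linarith) (by linarith [hg s hq' hp' h])

theorem inner_projected_saddleField_nonpos (N : MultipathNetwork S R L) {g : S → ℝ → ℝ}
    (hg : ∀ s, AntitoneOn (g s) (Ici 0)) :
    ∀ p ∈ nonnegOrthant (R ⊕ L), ∀ q ∈ nonnegOrthant (R ⊕ L), inner ℝ (p - q)
      (projectedField (N.saddleField g) p - projectedField (N.saddleField g) q) ≤ 0 :=
  fun _ hp _ hq => (inner_projectedField_le _ hp hq).trans (N.inner_saddleField_nonpos hg hp hq)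

theorem exists_lipschitzWith_saddleField (N : MultipathNetwork S R L) {g : S → ℝ → ℝ}
    (hg : ∀ s, ∃ C, LipschitzWith C (g s)) : ∃ C, LipschitzWith C (N.saddleField g) := by
  have hsum : ∀ J : Finset (R ⊕ L), ∃ C, LipschitzWith C
      (fun z : EuclideanSpace ℝ (R ⊕ L) => ∑ i ∈ J, z i) := fun J => by
    have h : (fun z : EuclideanSpace ℝ (R ⊕ L) => ∑ i ∈ J, z i) =
        ⇑(∑ i ∈ J, (EuclideanSpace.proj i : EuclideanSpace ℝ (R ⊕ L) →L[ℝ] ℝ)) := by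
      ext z; simp
    rw [h]
    exact ⟨_, ContinuousLinearMap.lipschitz _⟩
  refine exists_lipschitzWith_euclidean fun i => ?_
  rcases i with r | l
  · obtain ⟨C, hC⟩ := hg (N.source r)
    obtain ⟨C₁, h1⟩ := hsum (Finset.map ⟨Sum.inl, Sum.inl_injective⟩ {r' | N.source r' = N.source r})
    obtain ⟨C₂, h2⟩ := hsum (Finset.map ⟨Sum.inr, Sum.inr_injective⟩ (N.links r))
    simp only [Finset.sum_map, Function.Embedding.coeFn_mk] at h1 h2
    exact ⟨_, (hC.comp h1).sub h2⟩
  · obtain ⟨C₁, h1⟩ := hsum (Finset.map ⟨Sum.inl, Sum.inl_injective⟩ {r | l ∈ N.links r})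
    simp only [Finset.sum_map, Function.Embedding.coeFn_mk] at h1
    exact ⟨_, h1.sub (LipschitzWith.const (N.capacity l))⟩

theorem linkMatrix_mulVec (N : MultipathNetwork S R L) (x : R → ℝ) :
    N.linkMatrix *ᵥ x = N.linkLoad x := by
  ext l
  simp [linkMatrix, Matrix.mulVec, dotProduct, linkLoad, Finset.sum_filter]

theorem transpose_linkMatrix_mulVec (N : MultipathNetwork S R L) (y : L → ℝ) (r : R) :
    (N.linkMatrixᵀ *ᵥ y) r = ∑ l ∈ N.links r, y l := by
  simp [linkMatrix, Matrix.mulVec, dotProduct]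

theorem sourceMatrix_mulVec (N : MultipathNetwork S R L) (x : R → ℝ) :
    N.sourceMatrix *ᵥ x = N.sourceRate x := by
  ext s
  simp [sourceMatrix, Matrix.mulVec, dotProduct, sourceRate, Finset.sum_filter]

/-- The Lagrangian is affine in each price and y₀ is an interior minimiser, so the slope vanishes.
-/
theorem IsSaddlePoint.linkLoad_eq {N : MultipathNetwork S R L} {U : S → ℝ → ℝ} {x₀ : R → ℝ}
    {y₀ : L → ℝ} (h : N.IsSaddlePoint U x₀ y₀) (hy₀ : ∀ l, 0 < y₀ l) (l : L) :
    N.linkLoad x₀ l = N.capacity l := by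
  -- Perturbing one price by c stays admissible down to c = -y₀ l; the two choices c = ±y₀ l give
  -- opposite inequalities.
  have key : ∀ c, -y₀ l ≤ c → 0 ≤ c * (N.capacity l - N.linkLoad x₀ l) := fun c hc => by
    have := h.2.2.2 (y₀ + Pi.single l c) fun l' => by
      by_cases hl : l' = l
      · subst hl; simpa using by linarith
      · simpa [hl] using (hy₀ l').le
    simp only [lagrangian, add_dotProduct, linkMatrix_mulVec, single_dotProduct,
      Pi.sub_apply] at this
    linarith
  have h1 := key (-y₀ l) le_rfl
  have h2 := key (y₀ l) (by linarith [hy₀ l])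
  nlinarith [hy₀ l]

theorem sourceRate_pos (N : MultipathNetwork S R L) {x₀ : R → ℝ} (hx₀ : ∀ r, 0 < x₀ r) (r : R) :
    0 < N.sourceRate x₀ (N.source r) :=
  Finset.sum_pos (fun r' _ => hx₀ r') ⟨r, by simp⟩

/-- Fermat's rule for varying the single route r: x₀ r is positive, so both signs of the variation
are admissible, and the source rate is positive, so the one-sided derivative is a genuine one. -/
theorem IsSaddlePoint.derivWithin_eq {N : MultipathNetwork S R L} {U : S → ℝ → ℝ} {x₀ : R → ℝ}
    {y₀ : L → ℝ} (h : N.IsSaddlePoint U x₀ y₀) (hU : ∀ s, ContDiffOn ℝ 2 (U s) (Ici 0))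
    (hx₀ : ∀ r, 0 < x₀ r) (r : R) :
    derivWithin (U (N.source r)) (Ici 0) (N.sourceRate x₀ (N.source r))
      = ∑ l ∈ N.links r, y₀ l := by
  classical
  set s := N.source r with hs
  set a := N.sourceRate x₀ s with ha
  set c := ∑ l ∈ N.links r, y₀ l with hc
  have hmax : IsLocalMax (fun t => U s (a + t) - t * c) 0 := by
    filter_upwards [Ioi_mem_nhds (show -x₀ r < 0 by linarith [hx₀ r])] with t ht
    have ht' : -x₀ r < t := ht
    have h1 := h.2.2.1 (x₀ + Pi.single r t) fun r' => by
      by_cases hr : r' = r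
      · subst hr; simpa using by linarith
      · simpa [hr] using (hx₀ r').le
    have h2 : ∀ s', N.sourceRate (x₀ + Pi.single r t) s' =
        N.sourceRate x₀ s' + if s = s' then t else 0 := fun s' => by
      simp [sourceRate, Finset.sum_add_distrib, hs]
    have h3 : N.linkMatrix *ᵥ Pi.single r t = fun l => t * (if l ∈ N.links r then 1 else 0) := by
      ext l; simp [linkMatrix]
    have h4 : y₀ ⬝ᵥ (fun l => t * (if l ∈ N.links r then (1 : ℝ) else 0)) = t * c := by
      simp [dotProduct, hc, Finset.mul_sum, mul_comm]
    have h5 : ∑ s', (U s' (N.sourceRate x₀ s' + if s = s' then t else 0)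
        - U s' (N.sourceRate x₀ s')) = U s (a + t) - U s a := by
      rw [Finset.sum_eq_single s (fun s' _ hne => by simp [Ne.symm hne]) (by simp)]
      simp [ha]
    rw [Finset.sum_sub_distrib] at h5
    simp only [lagrangian, h2, Matrix.mulVec_add, h3, ← sub_sub, dotProduct_sub, h4] at h1
    simp only [add_zero, zero_mul, sub_zero]
    linarith
  have hapos : 0 < a := N.sourceRate_pos hx₀ r
  have hd : HasDerivAt (U s) (derivWithin (U s) (Ici 0) a) a :=
    (((hU s).differentiableOn (by norm_num) a hapos.le).hasDerivWithinAt).hasDerivAt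
      (Ici_mem_nhds hapos)
  have hd2 : HasDerivAt (fun t => U s (a + t) - t * c) (derivWithin (U s) (Ici 0) a - 1 * c) 0 := by
    refine HasDerivAt.sub ?_ ((hasDerivAt_id' (0 : ℝ)).mul_const c)
    exact HasDerivAt.comp_const_add a 0 (by simpa using hd)
  have := hmax.hasDerivAt_eq_zero hd2
  linarith

theorem IsSaddlePoint.saddleField_eq_zero {N : MultipathNetwork S R L} {U : S → ℝ → ℝ}
    {x₀ : R → ℝ} {y₀ : L → ℝ} (h : N.IsSaddlePoint U x₀ y₀)
    (hU : ∀ s, ContDiffOn ℝ 2 (U s) (Ici 0)) (hx₀ : ∀ r, 0 < x₀ r) (hy₀ : ∀ l, 0 < y₀ l)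
    : N.saddleField (fun s => derivWithin (U s) (Ici 0)) (WithLp.toLp 2 (Sum.elim x₀ y₀)) = 0 := by
  ext i
  rcases i with r | l
  · simp [saddleField, h.derivWithin_eq hU hx₀ r]
  · simp [saddleField, h.linkLoad_eq hy₀ l]

theorem sourceRate_le (N : MultipathNetwork S R L) {p e : EuclideanSpace ℝ (R ⊕ L)} {ρ : ℝ}
    (he : e ∈ nonnegOrthant (R ⊕ L)) (h : dist p e ≤ ρ) (s : S) :
    N.sourceRate (fun r => p (.inl r)) s ≤ ∑ r, (e (.inl r) + ρ) := by
  have hρ : 0 ≤ ρ := dist_nonneg.trans h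
  refine (Finset.sum_le_sum fun r _ => ?_).trans
    (Finset.sum_le_sum_of_subset_of_nonneg (Finset.subset_univ _) fun r _ _ =>
      add_nonneg (he _) hρ)
  have h1 := (PiLp.norm_apply_le (p - e) (.inl r)).trans ((dist_eq_norm p e).symm.le.trans h)
  rw [Real.norm_eq_abs, PiLp.sub_apply] at h1
  linarith [(abs_le.1 h1).2]

theorem exists_caratheodorySolution (N : MultipathNetwork S R L) {g : S → ℝ → ℝ}
    (hg : ∀ s, AntitoneOn (g s) (Ici 0)) (hgc : ∀ s, ContDiffOn ℝ 1 (g s) (Ici 0))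
    {e : EuclideanSpace ℝ (R ⊕ L)} (he : e ∈ nonnegOrthant (R ⊕ L)) (he0 : N.saddleField g e = 0)
    {p : EuclideanSpace ℝ (R ⊕ L)} (hp : p ∈ nonnegOrthant (R ⊕ L)) :
    ∃ z : ℝ → EuclideanSpace ℝ (R ⊕ L), z 0 = p ∧ (∀ t, 0 ≤ t → z t ∈ nonnegOrthant (R ⊕ L)) ∧
      IsCaratheodorySolution (projectedField (N.saddleField g)) z := by
  set B := ∑ r, (e (Sum.inl r) + dist p e) with hB_def
  have hB : 0 ≤ B := Finset.sum_nonneg fun r _ => add_nonneg (he _) dist_nonneg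
  let g' : S → ℝ → ℝ := fun s => IccExtend hB ((Icc 0 B).domRestrict (g s))
  have hg' : ∀ s, ∃ C, LipschitzWith C (g' s) := fun s => by
    obtain ⟨C, hC⟩ := ((hgc s).mono Icc_subset_Ici_self).exists_lipschitzOnWith one_ne_zero
      (convex_Icc 0 B) isCompact_Icc
    exact ⟨_, (lipschitzOnWith_iff_restrict.1 hC).comp (LipschitzWith.projIcc hB)⟩
  have hanti : ∀ s, Antitone (g' s) := fun s x y hxy =>
    hg s (projIcc 0 B hB x).2.1 (projIcc 0 B hB y).2.1 (monotone_projIcc hB hxy)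
  have hfield : ∀ q ∈ nonnegOrthant (R ⊕ L), dist q e ≤ dist p e →
      N.saddleField g' q = N.saddleField g q := fun q hq hqe => by
    have h1 : ∀ s, g' s (N.sourceRate (fun r => q (.inl r)) s) =
        g s (N.sourceRate (fun r => q (.inl r)) s) := fun s =>
      IccExtend_of_mem hB _ ⟨N.sourceRate_nonneg hq s, N.sourceRate_le he hqe s⟩
    simp only [saddleField, h1]
  obtain ⟨C, hC⟩ := N.exists_lipschitzWith_saddleField hg'
  obtain ⟨z, hz0, hzK, hz⟩ := exists_caratheodorySolution_of_lipschitz hC hp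
  have hconst : IsCaratheodorySolution (projectedField (N.saddleField g')) fun _ => e :=
    isCaratheodorySolution_const (projectedField_eq_zero
      (by rw [hfield e he (by simp [dist_nonneg]), he0]))
  have hdist := hz.antitoneOn_dist
    (N.inner_projected_saddleField_nonpos fun s => (hanti s).antitoneOn _) hconst hzK fun _ _ => he
  refine ⟨z, hz0, hzK, hz.1, ?_⟩
  filter_upwards [hz.2, ae_restrict_mem measurableSet_Ioi] with t h1 ht
  have ht' : (0 : ℝ) < t := ht
  have h2 : dist (z t) e ≤ dist p e := by
    have := hdist self_mem_Ici (show t ∈ Ici 0 from ht'.le) ht'.le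
    simpa [hz0] using this
  have h3 : projectedField (N.saddleField g) (z t) = projectedField (N.saddleField g') (z t) := by
    simp only [projectedField, hfield _ (hzK t ht'.le) h2]
  rwa [h3]

end MultipathNetwork

/-! ### Classical derivatives and unobservable linear flows -/

/-- Subtracting the primitive of w leaves an absolutely continuous function with derivative 0 almost
everywhere, hence a constant. Repeated differentiation later needs derivatives at every positive
time. -/
theorem hasDerivAt_of_ae_hasDerivAt {E : Type*} [NormedAddCommGroup E] [NormedSpace ℝ E]
    [CompleteSpace E] {z w : ℝ → E} (hz : ∀ T : ℝ, 0 ≤ T → AbsolutelyContinuousOnInterval z 0 T)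
    (hw : Continuous w) (h : ∀ᵐ t ∂(volume.restrict (Ioi (0 : ℝ))), HasDerivAt z (w t) t)
    {t : ℝ} (ht : 0 < t) : HasDerivAt z (w t) t := by
  have hI : ∀ s, HasDerivAt (fun s => ∫ r in (0 : ℝ)..s, w r) (w s) s := fun s =>
    (hw.integral_hasStrictDerivAt 0 s).hasDerivAt
  have hI1 : ContDiff ℝ 1 (fun s => ∫ r in (0 : ℝ)..s, w r) := by
    rw [contDiff_one_iff_deriv]
    refine ⟨fun s => (hI s).differentiableAt, ?_⟩
    rwa [show deriv (fun s => ∫ r in (0 : ℝ)..s, w r) = w from funext fun s => (hI s).deriv]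
  have hac := (hz (t + 1) (by positivity)).sub
    (hI1.contDiffOn (s := uIcc 0 (t + 1))).absolutelyContinuousOnInterval
  rw [ae_restrict_iff' measurableSet_Ioi] at h
  obtain ⟨C, hC⟩ := hac.const_of_ae_hasDerivAt_zero (by
    filter_upwards [h, compl_mem_ae_iff.2 (measure_singleton (0 : ℝ))] with s hs hs0 hsI
    rw [uIcc_of_le (by positivity)] at hsI
    have := (hs (lt_of_le_of_ne hsI.1 (Ne.symm hs0))).sub (hI s)
    rwa [sub_self] at this)
  have hev : z =ᶠ[𝓝 t] fun s => (∫ r in (0 : ℝ)..s, w r) + C := by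
    filter_upwards [Ioo_mem_nhds ht (lt_add_one t)] with s hs
    have := hC s (by rw [uIcc_of_le (by positivity)]; exact ⟨hs.1.le, hs.2.le⟩)
    rw [Pi.sub_apply, sub_eq_iff_eq_add] at this
    rw [this, add_comm]
  exact ((hI t).add_const C).congr_of_eventuallyEq hev

theorem forall_pos_eq_of_ae {X : Type*} [TopologicalSpace X] [T2Space X] {a b : ℝ → X}
    (ha : Continuous a) (hb : Continuous b)
    (h : ∀ᵐ t ∂(volume.restrict (Ioi (0 : ℝ))), a t = b t) {t : ℝ} (ht : 0 < t) : a t = b t :=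
  Measure.eqOn_open_of_ae_eq h isOpen_Ioi ha.continuousOn hb.continuousOn ht

theorem Matrix.mulVec_deriv_eq_zero {m n : Type*} [Fintype m] [Fintype n] (B : Matrix m n ℝ)
    {x : ℝ → n → ℝ} {x' : n → ℝ} {t : ℝ} (ht : 0 < t) (hx : HasDerivAt x x' t)
    (h : ∀ s, 0 < s → B *ᵥ x s = 0) : B *ᵥ x' = 0 := by
  have h1 := B.mulVecLin.toContinuousLinearMap.hasFDerivAt.comp_hasDerivAt t hx
  have h2 : HasDerivAt (B.mulVecLin.toContinuousLinearMap ∘ x) 0 t := by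
    refine (hasDerivAt_const t (0 : m → ℝ)).congr_of_eventuallyEq ?_
    filter_upwards [Ioi_mem_nhds ht] with s hs using h s hs
  exact h1.unique h2

theorem Matrix.transpose_mul_self_mulVec_eq_zero_iff {m n : Type*} [Fintype m] [Fintype n]
    (A : Matrix m n ℝ) (x : n → ℝ) : (Aᵀ * A) *ᵥ x = 0 ↔ A *ᵥ x = 0 := by
  simpa using A.conjTranspose_mul_self_mulVec_eq_zero x

/-- If the whole `AᵀA`-orbit of `x` lies in `ker H` and `ker H` contains no eigenvector of `AᵀA`
with positive eigenvalue, then `A x = 0`. -/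
theorem Matrix.mulVec_eq_zero_of_unobservable {k m n : Type*} [Fintype k] [Fintype m] [Fintype n]
    [DecidableEq n] (A : Matrix m n ℝ) (H : Matrix k n ℝ)
    (h : ¬ ∃ u : n → ℝ, u ≠ 0 ∧ H *ᵥ u = 0 ∧ ∃ c : ℝ, 0 < c ∧ (Aᵀ * A) *ᵥ u = c • u)
    {x : n → ℝ} (hx : ∀ j : ℕ, H *ᵥ ((Aᵀ * A) ^ j *ᵥ x) = 0) : A *ᵥ x = 0 := by
  set M := Aᵀ * A with hM
  have hMH : M.IsHermitian := by
    simpa using Matrix.isHermitian_conjTranspose_mul_self A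
  let T : EuclideanSpace ℝ n →ₗ[ℝ] EuclideanSpace ℝ n := Matrix.toEuclideanLin M
  have hT : T.IsSymmetric := Matrix.isSymmetric_toEuclideanLin_iff.2 hMH
  have hTa : ∀ v : EuclideanSpace ℝ n, (T v).ofLp = M *ᵥ v.ofLp := fun v => rfl
  let W : Submodule ℝ (EuclideanSpace ℝ n) :=
    { carrier := {v | ∀ j : ℕ, H *ᵥ (M ^ j *ᵥ v.ofLp) = 0}
      add_mem' := fun {v w} hv hw j => by
        simp only [WithLp.ofLp_add, Matrix.mulVec_add, hv j, hw j, add_zero]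
      zero_mem' := fun j => by simp
      smul_mem' := fun c v hv j => by
        simp only [WithLp.ofLp_smul, Matrix.mulVec_smul, hv j, smul_zero] }
  -- Intersecting with the complement of the kernel removes the eigenvalue 0. Any eigenvector left
  -- in V would be a forbidden one, so V is trivial; it contains T x because the range of T is
  -- orthogonal to its kernel.
  let V : Submodule ℝ (EuclideanSpace ℝ n) := W ⊓ (LinearMap.ker T)ᗮ
  have hrange : ∀ v, T v ∈ (LinearMap.ker T)ᗮ := fun v => by
    rw [Submodule.mem_orthogonal]
    intro u hu
    rw [← hT, LinearMap.mem_ker.1 hu, inner_zero_left]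
  have hWT : ∀ v ∈ W, T v ∈ W := fun v hv j => by
    rw [hTa, Matrix.mulVec_mulVec _ (M ^ j) M, ← pow_succ]
    exact hv (j + 1)
  have hVT : ∀ v ∈ V, T v ∈ V := fun v hv => ⟨hWT v hv.1, hrange v⟩
  have hsub : Subsingleton V := by
    refine (hT.restrict_invariant hVT).subsingleton_of_no_eigenvalue_finiteDimensional fun c => ?_
    rw [Submodule.eq_bot_iff]
    intro v hv
    have hv1 : T v = c • (v : EuclideanSpace ℝ n) :=
      congrArg Subtype.val (Module.End.mem_eigenspace_iff.1 hv)
    have hv2 : M *ᵥ (v : EuclideanSpace ℝ n).ofLp = c • (v : EuclideanSpace ℝ n).ofLp := by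
      rw [← hTa, hv1]; rfl
    by_contra hne
    have hne' : (v : EuclideanSpace ℝ n) ≠ 0 := fun h0 => hne (Subtype.ext h0)
    have hne2 : (v : EuclideanSpace ℝ n).ofLp ≠ 0 := fun h0 => hne' (by ext i; rw [h0]; rfl)
    have hc0 : c ≠ 0 := by
      rintro rfl
      have hker : (v : EuclideanSpace ℝ n) ∈ LinearMap.ker T := by
        rw [LinearMap.mem_ker, hv1, zero_smul]
      exact hne' (inner_self_eq_zero.1 (Submodule.inner_right_of_mem_orthogonal hker v.2.2))
    have hcnn : 0 ≤ c := by
      have h1 : (v : EuclideanSpace ℝ n).ofLp ⬝ᵥ (M *ᵥ (v : EuclideanSpace ℝ n).ofLp) =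
          (A *ᵥ (v : EuclideanSpace ℝ n).ofLp) ⬝ᵥ (A *ᵥ (v : EuclideanSpace ℝ n).ofLp) := by
        rw [hM, ← Matrix.mulVec_mulVec, Matrix.dotProduct_mulVec, Matrix.vecMul_transpose]
      rw [hv2, dotProduct_smul, smul_eq_mul] at h1
      have h2 : 0 ≤ (A *ᵥ (v : EuclideanSpace ℝ n).ofLp) ⬝ᵥ (A *ᵥ (v : EuclideanSpace ℝ n).ofLp) :=
        Finset.sum_nonneg fun i _ => mul_self_nonneg _
      have h3 : 0 < (v : EuclideanSpace ℝ n).ofLp ⬝ᵥ (v : EuclideanSpace ℝ n).ofLp :=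
        lt_of_le_of_ne (Finset.sum_nonneg fun i _ => mul_self_nonneg _)
          (Ne.symm fun h0 => hne2 (dotProduct_self_eq_zero.1 h0))
      by_contra hneg
      nlinarith
    exact h ⟨_, hne2, by simpa using v.2.1 0, c, lt_of_le_of_ne hcnn hc0.symm, hv2⟩
  have hxW : WithLp.toLp 2 x ∈ W := hx
  have h0 : (⟨T (WithLp.toLp 2 x), hWT _ hxW, hrange _⟩ : V) = 0 := Subsingleton.elim _ _
  have h1 : T (WithLp.toLp 2 x) = 0 := congrArg Subtype.val h0
  rw [← Matrix.transpose_mul_self_mulVec_eq_zero_iff]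
  exact congrArg WithLp.ofLp h1

/-- Two derivatives of H (AᵀA)^j x = 0 give H (AᵀA)^(j+1) x = 0. Once A x vanishes identically, its
derivative gives A Aᵀ y = 0, hence Aᵀ y = 0. -/
theorem Matrix.eq_zero_of_unobservable_flow {k m n : Type*} [Fintype k] [Fintype m] [Fintype n]
    (A : Matrix m n ℝ) (H : Matrix k n ℝ)
    (h : ¬ ∃ u : n → ℝ, u ≠ 0 ∧ H *ᵥ u = 0 ∧ ∃ c : ℝ, 0 < c ∧ (Aᵀ * A) *ᵥ u = c • u)
    {x : ℝ → n → ℝ} {y : ℝ → m → ℝ} (hx : ∀ t, 0 < t → HasDerivAt x (-(Aᵀ *ᵥ y t)) t)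
    (hy : ∀ t, 0 < t → HasDerivAt y (A *ᵥ x t) t) (hH : ∀ t, 0 < t → H *ᵥ x t = 0)
    {t : ℝ} (ht : 0 < t) : A *ᵥ x t = 0 ∧ Aᵀ *ᵥ y t = 0 := by
  classical
  have hk : ∀ j : ℕ, ∀ t, 0 < t → (H * (Aᵀ * A) ^ j) *ᵥ x t = 0 := by
    intro j
    induction j with
    | zero => simpa using hH
    | succ j ih =>
      have h1 : ∀ t, 0 < t → (H * (Aᵀ * A) ^ j * Aᵀ) *ᵥ y t = 0 := fun t ht => by
        have := Matrix.mulVec_deriv_eq_zero _ ht (hx t ht) ih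
        rwa [Matrix.mulVec_neg, neg_eq_zero, Matrix.mulVec_mulVec] at this
      intro t ht
      have := Matrix.mulVec_deriv_eq_zero _ ht (hy t ht) h1
      rwa [Matrix.mulVec_mulVec, Matrix.mul_assoc, Matrix.mul_assoc, ← pow_succ] at this
  have hA : ∀ t, 0 < t → A *ᵥ x t = 0 := fun t ht =>
    A.mulVec_eq_zero_of_unobservable H h fun j => by
      rw [Matrix.mulVec_mulVec]; exact hk j t ht
  refine ⟨hA t ht, ?_⟩
  have h1 := Matrix.mulVec_deriv_eq_zero A ht (hx t ht) hA
  rw [Matrix.mulVec_neg, neg_eq_zero] at h1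
  have h2 := (Matrix.transpose_mul_self_mulVec_eq_zero_iff Aᵀ (y t)).1
  rw [Matrix.transpose_transpose, ← Matrix.mulVec_mulVec] at h2
  exact h2 h1

/-! ### Rigidity of solutions at constant distance from the saddle point -/

theorem le_posProj (a : ℝ) {x : ℝ} : a ≤ posProj a x := by
  unfold posProj; split_ifs <;> simp

theorem posProj_mul_self (a : ℝ) {x : ℝ} (hx : 0 ≤ x) : posProj a x * x = a * x := by
  rcases hx.eq_or_lt with rfl | h
  · simp
  · rw [posProj_of_pos h]

theorem projectedField_of_pos {ι : Type*} (f : EuclideanSpace ℝ ι → EuclideanSpace ℝ ι)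
    {z : EuclideanSpace ℝ ι} (hz : ∀ i, 0 < z i) : projectedField f z = f z := by
  ext i
  exact posProj_of_pos (hz i)

theorem ae_inner_eq_zero_of_dist_const {ι : Type*} [Fintype ι]
    {v : EuclideanSpace ℝ ι → EuclideanSpace ℝ ι} {z : ℝ → EuclideanSpace ℝ ι}
    (hz : IsCaratheodorySolution v z) {e : EuclideanSpace ℝ ι}
    (hdist : ∀ t, 0 ≤ t → dist (z t) e = dist (z 0) e) :
    ∀ᵐ t ∂(volume.restrict (Ioi (0 : ℝ))), inner ℝ (z t - e) (v (z t)) = 0 := by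
  filter_upwards [hz.2, ae_restrict_mem measurableSet_Ioi] with t h1 ht
  have h2 := (h1.sub_const e).norm_sq
  have h3 : HasDerivAt (fun s => ‖z s - e‖ ^ 2) 0 t := by
    refine (hasDerivAt_const t (dist (z 0) e ^ 2)).congr_of_eventuallyEq ?_
    filter_upwards [Ioi_mem_nhds ht] with s hs
    rw [← dist_eq_norm, hdist s (le_of_lt hs)]
  linarith [h2.unique h3]

namespace MultipathNetwork

variable {S R L : Type*} [Fintype S] [Fintype R] [Fintype L] [DecidableEq S] [DecidableEq L]

/-- The pairing is a nonpositive utility term minus a sum of nonnegative terms e i · (projection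
excess), so if it is 0 both vanish. Strict monotonicity then fixes the source rates, and e i > 0
forces every excess to be 0. -/
theorem projectedField_eq_of_inner_eq_zero (N : MultipathNetwork S R L) {g : S → ℝ → ℝ}
    (hg : ∀ s, StrictAntiOn (g s) (Ici 0)) {e p : EuclideanSpace ℝ (R ⊕ L)}
    (he : ∀ i, 0 < e i) (he0 : N.saddleField g e = 0) (hp : p ∈ nonnegOrthant (R ⊕ L))
    (h : inner ℝ (p - e) (projectedField (N.saddleField g) p) = 0) :
    (∀ s, N.sourceRate (fun r => p (.inl r)) s = N.sourceRate (fun r => e (.inl r)) s) ∧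
      projectedField (N.saddleField g) p = N.saddleField g p := by
  have heK : e ∈ nonnegOrthant (R ⊕ L) := fun i => (he i).le
  set F := N.saddleField g p with hF
  -- The excess is nonzero only where p i = 0, so it pairs to 0 with p and only its pairing with -e
  -- survives.
  have h1 : inner ℝ (p - e) (projectedField (N.saddleField g) p) =
      inner ℝ (p - e) (F - N.saddleField g e) - ∑ i, e i * (posProj (F i) (p i) - F i) := by
    rw [he0, sub_zero, PiLp.inner_apply, PiLp.inner_apply, ← Finset.sum_sub_distrib]
    refine Finset.sum_congr rfl fun i _ => ?_
    have := posProj_mul_self (F i) (hp i)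
    simp only [projectedField, PiLp.sub_apply, RCLike.inner_apply, conj_trivial, ← hF]
    linarith
  have hnn : ∀ i ∈ Finset.univ, 0 ≤ e i * (posProj (F i) (p i) - F i) := fun i _ =>
    mul_nonneg (he i).le (sub_nonneg.2 (le_posProj _))
  have h2 := N.inner_saddleField_nonpos (fun s => (hg s).antitoneOn) hp heK
  have h3 := Finset.sum_nonneg hnn
  rw [h1] at h
  constructor
  · have h4 : inner ℝ (p - e) (F - N.saddleField g e) = 0 := le_antisymm h2 (by linarith)
    rw [hF, inner_saddleField] at h4
    have hterm : ∀ s, (N.sourceRate (fun r => p (.inl r)) s - N.sourceRate (fun r => e (.inl r)) s)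
        * (g s (N.sourceRate (fun r => p (.inl r)) s) -
          g s (N.sourceRate (fun r => e (.inl r)) s)) ≤ 0 ∧
        (N.sourceRate (fun r => p (.inl r)) s ≠ N.sourceRate (fun r => e (.inl r)) s →
        (N.sourceRate (fun r => p (.inl r)) s - N.sourceRate (fun r => e (.inl r)) s)
        * (g s (N.sourceRate (fun r => p (.inl r)) s) -
          g s (N.sourceRate (fun r => e (.inl r)) s)) ≠ 0) := fun s => by
      have hp' := N.sourceRate_nonneg hp s
      have hq' := N.sourceRate_nonneg heK s
      rcases lt_trichotomy (N.sourceRate (fun r => p (.inl r)) s)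
        (N.sourceRate (fun r => e (.inl r)) s) with h | h | h
      · have := mul_neg_of_neg_of_pos (sub_neg.2 h) (sub_pos.2 (hg s hp' hq' h))
        exact ⟨this.le, fun _ => this.ne⟩
      · simp [h]
      · have := mul_neg_of_pos_of_neg (sub_pos.2 h) (sub_neg.2 (hg s hq' hp' h))
        exact ⟨this.le, fun _ => this.ne⟩
    intro s
    by_contra hne
    exact (hterm s).2 hne ((Finset.sum_eq_zero_iff_of_nonpos fun s _ => (hterm s).1).1 h4 s
      (Finset.mem_univ s))
  · have h4 : ∑ i, e i * (posProj (F i) (p i) - F i) = 0 := le_antisymm (by linarith) h3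
    ext i
    have h5 := (Finset.sum_eq_zero_iff_of_nonneg hnn).1 h4 i (Finset.mem_univ i)
    have h6 := (mul_eq_zero.1 h5).resolve_left (he i).ne'
    exact sub_eq_zero.1 h6

/-- The linearised field at a stationary point `e`, valid where the source rates agree. -/
noncomputable def linearField (N : MultipathNetwork S R L) (e z : EuclideanSpace ℝ (R ⊕ L)) :
    EuclideanSpace ℝ (R ⊕ L) :=
  WithLp.toLp 2 (Sum.elim
    (-(N.linkMatrixᵀ *ᵥ fun l => z (.inr l) - e (.inr l)))
    (N.linkMatrix *ᵥ fun r => z (.inl r) - e (.inl r)))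

theorem saddleField_eq_linearField (N : MultipathNetwork S R L) {g : S → ℝ → ℝ}
    {e z : EuclideanSpace ℝ (R ⊕ L)} (he0 : N.saddleField g e = 0)
    (h : ∀ s, N.sourceRate (fun r => z (.inl r)) s = N.sourceRate (fun r => e (.inl r)) s) :
    N.saddleField g z = N.linearField e z := by
  rw [← sub_zero (N.saddleField g z), ← he0]
  ext i
  rcases i with r | l
  · simp [saddleField, linearField, transpose_linkMatrix_mulVec, h]
  · simp [saddleField, linearField, linkMatrix_mulVec, linkLoad_sub]

theorem continuous_linearField (N : MultipathNetwork S R L) (e : EuclideanSpace ℝ (R ⊕ L)) :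
    Continuous (N.linearField e) := by
  refine (PiLp.continuous_toLp 2 _).comp (continuous_pi fun i => ?_)
  rcases i with r | l
  · simp only [Sum.elim_inl, Pi.neg_apply, transpose_linkMatrix_mulVec]
    fun_prop
  · simp only [Sum.elim_inr, linkMatrix_mulVec, linkLoad]
    fun_prop

theorem hasDerivAt_linearField_iff (N : MultipathNetwork S R L) {e : EuclideanSpace ℝ (R ⊕ L)}
    {z : ℝ → EuclideanSpace ℝ (R ⊕ L)} {t : ℝ} :
    HasDerivAt z (N.linearField e (z t)) t ↔
      HasDerivAt (fun t r => z t (.inl r) - e (.inl r))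
        (-(N.linkMatrixᵀ *ᵥ fun l => z t (.inr l) - e (.inr l))) t ∧
      HasDerivAt (fun t l => z t (.inr l) - e (.inr l))
        (N.linkMatrix *ᵥ fun r => z t (.inl r) - e (.inl r)) t := by
  have h1 : HasDerivAt z (N.linearField e (z t)) t ↔
      HasDerivAt (fun t => (z t).ofLp) (N.linearField e (z t)).ofLp t :=
    ⟨fun h => (PiLp.continuousLinearEquiv 2 ℝ
        (fun _ : R ⊕ L => ℝ)).hasFDerivAt.comp_hasDerivAt t h,
      fun h => (PiLp.continuousLinearEquiv 2 ℝ
        (fun _ : R ⊕ L => ℝ)).symm.hasFDerivAt.comp_hasDerivAt t h⟩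
  rw [h1, hasDerivAt_pi, hasDerivAt_pi, hasDerivAt_pi]
  simp only [hasDerivAt_sub_const_iff]
  exact ⟨fun h => ⟨fun r => h (.inl r), fun l => h (.inr l)⟩,
    fun h i => i.rec (fun r => h.1 r) (fun l => h.2 l)⟩

theorem eq_of_dist_const (N : MultipathNetwork S R L) {g : S → ℝ → ℝ}
    (hg : ∀ s, StrictAntiOn (g s) (Ici 0)) {e : EuclideanSpace ℝ (R ⊕ L)}
    (he : ∀ i, 0 < e i) (he0 : N.saddleField g e = 0)
    (hno : ¬ ∃ u : R → ℝ, u ≠ 0 ∧ N.sourceMatrix *ᵥ u = 0 ∧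
      ∃ c : ℝ, 0 < c ∧ (N.linkMatrixᵀ * N.linkMatrix) *ᵥ u = c • u)
    {z : ℝ → EuclideanSpace ℝ (R ⊕ L)} (hzc : Continuous z)
    (hzK : ∀ t, 0 ≤ t → z t ∈ nonnegOrthant (R ⊕ L))
    (hz : IsCaratheodorySolution (projectedField (N.saddleField g)) z)
    (hdist : ∀ t, 0 ≤ t → dist (z t) e = dist (z 0) e) {t : ℝ} (ht : 0 ≤ t) : z t = z 0 := by
  have hae : ∀ᵐ t ∂(volume.restrict (Ioi (0 : ℝ))),
      (∀ s, N.sourceRate (fun r => z t (.inl r)) s = N.sourceRate (fun r => e (.inl r)) s) ∧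
      projectedField (N.saddleField g) (z t) = N.saddleField g (z t) := by
    filter_upwards [ae_inner_eq_zero_of_dist_const hz hdist, ae_restrict_mem measurableSet_Ioi]
      with t h1 ht
    exact N.projectedField_eq_of_inner_eq_zero hg he he0 (hzK t (le_of_lt ht)) h1
  have hrate : ∀ t, 0 < t → ∀ s, N.sourceRate (fun r => z t (.inl r)) s =
      N.sourceRate (fun r => e (.inl r)) s := fun t ht s => by
    refine forall_pos_eq_of_ae (a := fun t => N.sourceRate (fun r => z t (.inl r)) s)
      (b := fun _ => _) ?_ continuous_const (hae.mono fun t h => h.1 s) ht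
    unfold sourceRate
    fun_prop
  have hlin : ∀ᵐ t ∂(volume.restrict (Ioi (0 : ℝ))), HasDerivAt z (N.linearField e (z t)) t := by
    filter_upwards [hae, hz.2] with t h1 h2
    rwa [h1.2, N.saddleField_eq_linearField he0 h1.1] at h2
  have hder : ∀ t, 0 < t → HasDerivAt z (N.linearField e (z t)) t := fun t ht =>
    hasDerivAt_of_ae_hasDerivAt hz.1 ((N.continuous_linearField e).comp hzc) hlin ht
  have hzero : ∀ t, 0 < t → N.linearField e (z t) = 0 := fun t ht => by
    have h1 := Matrix.eq_zero_of_unobservable_flow N.linkMatrix N.sourceMatrix hno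
      (fun t ht => (N.hasDerivAt_linearField_iff.1 (hder t ht)).1)
      (fun t ht => (N.hasDerivAt_linearField_iff.1 (hder t ht)).2)
      (fun t ht => by
        ext s
        rw [sourceMatrix_mulVec, sourceRate_sub, hrate t ht, sub_self, Pi.zero_apply]) ht
    rw [linearField, h1.1, h1.2, neg_zero]
    ext i
    rcases i with r | l <;> rfl
  -- The velocity is known to vanish only at positive times; absolute continuity on [0, t] extends
  -- the constancy to time 0.
  obtain ⟨C, hC⟩ := (hz.1 t ht).const_of_ae_hasDerivAt_zero (by
    filter_upwards [compl_mem_ae_iff.2 (measure_singleton (0 : ℝ))] with s hs0 hsI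
    rw [uIcc_of_le ht] at hsI
    have hs : 0 < s := lt_of_le_of_ne hsI.1 (Ne.symm hs0)
    exact hzero s hs ▸ hder s hs)
  rw [hC t right_mem_uIcc, hC 0 left_mem_uIcc]

end MultipathNetwork

/-! ### Periodic orbits as obstructions to convergence -/

theorem isClosed_equilibriumSet {X : Type*} [TopologicalSpace X] [T2Space X] (Φ : Flow ℝ≥0 X) :
    IsClosed (equilibriumSet Φ) := by
  simp only [equilibriumSet, Set.ofPred_forall]
  exact isClosed_iInter fun t => isClosed_eq (Φ.continuous_toFun t) continuous_id

theorem isClosed_nonnegOrthant (ι : Type*) [Fintype ι] : IsClosed (nonnegOrthant ι) := by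
  simp only [nonnegOrthant, Set.ofPred_forall]
  exact isClosed_iInter fun i => isClosed_le continuous_const (by fun_prop)

/-- A periodic point of a globally convergent semi-flow is an equilibrium. -/
theorem GloballyConvergent.mem_equilibriumSet_of_periodic {X : Type*} [MetricSpace X]
    {Φ : Flow ℝ≥0 X} (hΦ : GloballyConvergent Φ) {p : X} {T : ℝ≥0} (hT : 0 < T)
    (hp : Φ T p = p) : p ∈ equilibriumSet Φ := by
  have hn : ∀ n : ℕ, Φ (n • T) p = p := fun n => by
    induction n with
    | zero => rw [zero_smul, Φ.map_zero_apply]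
    | succ n ih => rw [succ_nsmul, Φ.map_add, hp, ih]
  have hlim : Tendsto (fun n : ℕ => n • T) atTop atTop :=
    tendsto_id.atTop_nsmul_const hT
  -- Sampled at multiples of T, the distance to the equilibria is constant, so its limit 0 is its
  -- value at p; closedness of the equilibrium set finishes.
  have h1 := (hΦ p).comp hlim
  simp only [Function.comp_def, hn] at h1
  have h2 : Metric.infEDist p (equilibriumSet Φ) = 0 :=
    tendsto_nhds_unique tendsto_const_nhds h1
  rwa [← Metric.mem_closure_iff_infEDist_zero, (isClosed_equilibriumSet Φ).closure_eq] at h2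

namespace MultipathNetwork

variable {S R L : Type*} [Fintype S] [Fintype R] [Fintype L] [DecidableEq S] [DecidableEq L]

/-- The harmonic oscillation around `e` in the direction `u`, with amplitude `ε` and angular
frequency `ω`. -/
noncomputable def oscillation (N : MultipathNetwork S R L) (e : EuclideanSpace ℝ (R ⊕ L))
    (u : R → ℝ) (ω ε t : ℝ) : EuclideanSpace ℝ (R ⊕ L) :=
  WithLp.toLp 2 (Sum.elim (fun r => e (.inl r) + ε * Real.cos (ω * t) * u r)
    (fun l => e (.inr l) + ε * (Real.sin (ω * t) / ω) * (N.linkMatrix *ᵥ u) l))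

theorem hasDerivAt_oscillation (N : MultipathNetwork S R L) (e : EuclideanSpace ℝ (R ⊕ L))
    {u : R → ℝ} {ω : ℝ} (hω : 0 < ω) (hu : (N.linkMatrixᵀ * N.linkMatrix) *ᵥ u = ω ^ 2 • u)
    (ε t : ℝ) :
    HasDerivAt (N.oscillation e u ω ε) (N.linearField e (N.oscillation e u ω ε t)) t := by
  have hin : HasDerivAt (fun t => ω * t) ω t := by simpa using (hasDerivAt_id' t).const_mul ω
  have hx : ∀ t, (fun r => N.oscillation e u ω ε t (.inl r) - e (.inl r)) =
      (ε * Real.cos (ω * t)) • u := fun t => by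
    ext r; simp [oscillation]
  have hy : ∀ t, (fun l => N.oscillation e u ω ε t (.inr l) - e (.inr l)) =
      (ε * (Real.sin (ω * t) / ω)) • (N.linkMatrix *ᵥ u) := fun t => by
    ext l; simp [oscillation]
  rw [hasDerivAt_linearField_iff, funext hx, funext hy, hx, hy]
  simp only [Matrix.mulVec_smul, Matrix.mulVec_mulVec, hu]
  constructor
  · refine (((hin.cos).const_mul ε).smul_const u).congr_deriv ?_
    rw [smul_smul, ← neg_smul]
    congr 1
    field_simp
  · refine ((((hin.sin).div_const ω).const_mul ε).smul_const _).congr_deriv ?_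
    congr 1
    field_simp

theorem exists_oscillation_pos (N : MultipathNetwork S R L) {e : EuclideanSpace ℝ (R ⊕ L)}
    (he : ∀ i, 0 < e i) (u : R → ℝ) (ω : ℝ) :
    ∃ ε, 0 < ε ∧ ∀ t i, 0 < N.oscillation e u ω ε t i := by
  have key : ∀ a b : ℝ, 0 < a → ∀ᶠ ε in 𝓝[>] (0 : ℝ), ε * |b| < a := fun a b ha => by
    have h : Tendsto (fun ε : ℝ => ε * |b|) (𝓝[>] 0) (𝓝 (0 * |b|)) :=
      (tendsto_id.mul_const _).mono_left nhdsWithin_le_nhds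
    rw [zero_mul] at h
    exact h.eventually (gt_mem_nhds ha)
  have h1 : ∀ᶠ ε in 𝓝[>] (0 : ℝ), (∀ r, ε * |u r| < e (.inl r)) ∧
      (∀ l, ε * |(N.linkMatrix *ᵥ u) l / ω| < e (.inr l)) ∧ 0 < ε :=
    (eventually_all.2 fun r => key _ _ (he _)).and
      ((eventually_all.2 fun l => key _ _ (he _)).and self_mem_nhdsWithin)
  obtain ⟨ε, hr, hl, hε⟩ := h1.exists
  have hbound : ∀ a b c : ℝ, |c| ≤ 1 → ε * |b| < a → 0 < a + ε * c * b := fun a b c hc hab => by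
    have h2 : |ε * c * b| ≤ ε * |b| := by
      rw [abs_mul, abs_mul, abs_of_pos hε]
      exact mul_le_mul_of_nonneg_right (mul_le_of_le_one_right hε.le hc) (abs_nonneg b)
    linarith [(abs_le.1 h2).1]
  refine ⟨ε, hε, fun t i => ?_⟩
  rcases i with r | l
  · exact hbound _ _ _ (Real.abs_cos_le_one _) (hr r)
  · have := hbound _ _ _ (Real.abs_sin_le_one (ω * t)) (hl l)
    have h3 : ε * (Real.sin (ω * t) / ω) * (N.linkMatrix *ᵥ u) l =
      ε * Real.sin (ω * t) * ((N.linkMatrix *ᵥ u) l / ω) := by ring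
    show 0 < e (.inr l) + ε * (Real.sin (ω * t) / ω) * (N.linkMatrix *ᵥ u) l
    rwa [h3]

/-- Since H u = 0, the oscillation keeps the source rates of e, where the field is exactly linear;
positivity switches the projection off. -/
theorem isCaratheodorySolution_oscillation (N : MultipathNetwork S R L) {g : S → ℝ → ℝ}
    {e : EuclideanSpace ℝ (R ⊕ L)} (he0 : N.saddleField g e = 0) {u : R → ℝ} {ω ε : ℝ}
    (hω : 0 < ω) (hu : (N.linkMatrixᵀ * N.linkMatrix) *ᵥ u = ω ^ 2 • u)
    (hHu : N.sourceMatrix *ᵥ u = 0) (hpos : ∀ t i, 0 < N.oscillation e u ω ε t i) :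
    IsCaratheodorySolution (projectedField (N.saddleField g)) (N.oscillation e u ω ε) := by
  have hd := N.hasDerivAt_oscillation e hω hu ε
  have hc : Continuous (N.oscillation e u ω ε) :=
    continuous_iff_continuousAt.2 fun t => (hd t).continuousAt
  have hcd : ContDiff ℝ 1 (N.oscillation e u ω ε) := by
    rw [contDiff_one_iff_deriv]
    refine ⟨fun t => (hd t).differentiableAt, ?_⟩
    rw [show deriv (N.oscillation e u ω ε) = fun t => N.linearField e (N.oscillation e u ω ε t)
      from funext fun t => (hd t).deriv]
    exact (N.continuous_linearField e).comp hc
  refine ⟨fun T _ => hcd.contDiffOn.absolutelyContinuousOnInterval,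
    Eventually.of_forall fun t => ?_⟩
  rw [projectedField_of_pos _ (hpos t), N.saddleField_eq_linearField he0]
  · exact hd t
  · intro s
    have h1 : N.sourceRate u s = 0 := by rw [← sourceMatrix_mulVec, hHu]; rfl
    have h2 : N.sourceRate (fun r => N.oscillation e u ω ε t (.inl r) - e (.inl r)) s =
        ε * Real.cos (ω * t) * N.sourceRate u s := by
      simp only [sourceRate, Finset.mul_sum]
      exact Finset.sum_congr rfl fun r _ => by simp [oscillation]
    rwa [sourceRate_sub, h1, mul_zero, sub_eq_zero] at h2

theorem not_globallyConvergent_of_eigenvector (N : MultipathNetwork S R L) {g : S → ℝ → ℝ}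
    {e : EuclideanSpace ℝ (R ⊕ L)} (he : ∀ i, 0 < e i) (he0 : N.saddleField g e = 0)
    {Φ : Flow ℝ≥0 (nonnegOrthant (R ⊕ L))}
    (hΦ : IsCaratheodorySemiflow (projectedField (N.saddleField g)) Φ) {u : R → ℝ} (hu : u ≠ 0)
    (hHu : N.sourceMatrix *ᵥ u = 0) {c : ℝ} (hc : 0 < c)
    (hcu : (N.linkMatrixᵀ * N.linkMatrix) *ᵥ u = c • u) : ¬ GloballyConvergent Φ := by
  intro hconv
  have hω : 0 < √c := Real.sqrt_pos.2 hc
  obtain ⟨ε, hε, hpos⟩ := N.exists_oscillation_pos he u (√c)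
  have hsol := N.isCaratheodorySolution_oscillation he0 hω (by rwa [Real.sq_sqrt hc.le]) hHu hpos
  let p : nonnegOrthant (R ⊕ L) := ⟨N.oscillation e u (√c) ε 0, fun i => (hpos 0 i).le⟩
  have hflow : ∀ t : ℝ≥0, N.oscillation e u (√c) ε t = Φ t p :=
    hΦ.2 p _ rfl (fun t _ i => (hpos t i).le) hsol
  have hosc : ∀ t : ℝ, ∀ r, N.oscillation e u (√c) ε t (.inl r) =
      e (.inl r) + ε * Real.cos (√c * t) * u r := fun _ _ => rfl
  -- T is the full period and T' half of it: at T' the cosine is -1, so being at rest would force ε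
  -- u = 0.
  let T : ℝ≥0 := ⟨2 * Real.pi / √c, by positivity⟩
  let T' : ℝ≥0 := ⟨Real.pi / √c, by positivity⟩
  have hT1 : √c * (T : ℝ) = 2 * Real.pi := mul_div_cancel₀ _ hω.ne'
  have hT2 : √c * (T' : ℝ) = Real.pi := mul_div_cancel₀ _ hω.ne'
  have hT : 0 < T := show (0 : ℝ) < 2 * Real.pi / √c by positivity
  have hper : Φ T p = p := by
    refine Subtype.ext ?_
    rw [← hflow T]
    show N.oscillation e u (√c) ε T = N.oscillation e u (√c) ε 0
    simp only [oscillation, hT1, mul_zero, Real.cos_two_pi, Real.sin_two_pi, Real.cos_zero,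
      Real.sin_zero]
  have heq : N.oscillation e u (√c) ε T' = N.oscillation e u (√c) ε 0 := by
    rw [hflow T', hconv.mem_equilibriumSet_of_periodic hT hper T']
  refine hu (funext fun r => ?_)
  have h1 := congrArg (fun z : EuclideanSpace ℝ (R ⊕ L) => z (.inl r)) heq
  simp only [hosc, hT2, mul_zero, Real.cos_pi, Real.cos_zero] at h1
  have h2 : ε * u r = 0 := by linarith
  exact (mul_eq_zero.1 h2).resolve_left hε.ne'

theorem globallyConvergent_of_no_eigenvector (N : MultipathNetwork S R L) {g : S → ℝ → ℝ}
    (hg : ∀ s, StrictAntiOn (g s) (Ici 0)) {e : EuclideanSpace ℝ (R ⊕ L)} (he : ∀ i, 0 < e i)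
    (he0 : N.saddleField g e = 0) {Φ : Flow ℝ≥0 (nonnegOrthant (R ⊕ L))}
    (hΦ : IsCaratheodorySemiflow (projectedField (N.saddleField g)) Φ)
    (hanti : ∀ p q, Antitone fun t => dist (Φ t p) (Φ t q))
    (hno : ¬ ∃ u : R → ℝ, u ≠ 0 ∧ N.sourceMatrix *ᵥ u = 0 ∧
      ∃ c : ℝ, 0 < c ∧ (N.linkMatrixᵀ * N.linkMatrix) *ᵥ u = c • u) : GloballyConvergent Φ := by
  have : ProperSpace (nonnegOrthant (R ⊕ L)) :=
    .of_isClosed (isClosed_nonnegOrthant (R ⊕ L))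
  refine globallyConvergent_of_nonexpansive Φ hanti (e := ⟨e, fun i => (he i).le⟩)
    (hΦ.mem_equilibriumSet (projectedField_eq_zero he0)) fun p hp t => Subtype.ext ?_
  have hc : Continuous fun t : ℝ => (Φ t.toNNReal p : EuclideanSpace ℝ (R ⊕ L)) :=
    continuous_subtype_val.comp (Φ.continuous continuous_real_toNNReal continuous_const)
  have h1 := N.eq_of_dist_const hg he he0 hno hc (fun t _ => (Φ t.toNNReal p).2) (hΦ.1 p)
    (fun t _ => by
      simp only [Real.toNNReal_zero, Φ.map_zero_apply]
      exact hp t.toNNReal) t.coe_nonneg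
  simpa only [Real.toNNReal_coe, Real.toNNReal_zero, Φ.map_zero_apply] using h1

end MultipathNetwork

/-! ### The convergence criterion -/

theorem mainTheorem9 {S R L : Type*} [Fintype S] [Fintype R] [Fintype L]
    [DecidableEq S] [DecidableEq L]
    (N : MultipathNetwork S R L) (U : S → ℝ → ℝ)
    (hU_smooth : ∀ s, ContDiffOn ℝ 2 (U s) (Ici 0))
    (hU_concave : ∀ s, StrictConcaveOn ℝ (Ici 0) (U s))
    (hU_mono : ∀ s, StrictMonoOn (U s) (Ici 0))
    (x₀ : R → ℝ) (y₀ : L → ℝ)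
    (hsaddle : N.IsSaddlePoint U x₀ y₀) (hx₀ : ∀ r, 0 < x₀ r) (hy₀ : ∀ l, 0 < y₀ l) :
    ∃ Φ : Flow ℝ≥0 (nonnegOrthant (R ⊕ L)),
      IsCaratheodorySemiflow (N.subgradientField U) Φ ∧
      (GloballyConvergent Φ ↔
        ¬ ∃ u : R → ℝ, u ≠ 0 ∧ N.sourceMatrix *ᵥ u = 0 ∧
          ∃ c : ℝ, 0 < c ∧ (N.linkMatrixᵀ * N.linkMatrix) *ᵥ u = c • u) := by
  rw [N.subgradientField_eq]
  have hg : ∀ s, StrictAntiOn (derivWithin (U s) (Ici 0)) (Ici 0) := fun s =>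
    (hU_concave s).strictAntiOn_derivWithin ((hU_smooth s).differentiableOn (by norm_num))
  have hgc : ∀ s, ContDiffOn ℝ 1 (derivWithin (U s) (Ici 0)) (Ici 0) := fun s =>
    (hU_smooth s).derivWithin (uniqueDiffOn_Ici 0) (by norm_num)
  have he0 := hsaddle.saddleField_eq_zero hU_smooth hx₀ hy₀
  have he : ∀ i, 0 < (WithLp.toLp 2 (Sum.elim x₀ y₀) : EuclideanSpace ℝ (R ⊕ L)) i := fun i =>
    i.rec hx₀ hy₀
  obtain ⟨Φ, hΦ, hanti⟩ := exists_semiflow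
    (N.inner_projected_saddleField_nonpos fun s => (hg s).antitoneOn) fun p hp =>
      N.exists_caratheodorySolution (fun s => (hg s).antitoneOn) hgc (fun i => (he i).le) he0 hp
  refine ⟨Φ, hΦ, fun hconv => ?_, N.globallyConvergent_of_no_eigenvector hg he he0 hΦ hanti⟩
  rintro ⟨u, hu, hHu, c, hc, hcu⟩
  exact N.not_globallyConvergent_of_eigenvector he he0 hΦ hu hHu hc hcu hconv
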